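/- **Setting.** Let $(G_{samp},W)$ be a finite bipartite graph $G_{samp}=(V_2,V_1,E_s)$ with a probability distribution $W$ on $V_2$, where every $T\in V_2$ with $W(T)>0$ has a neighbour. Let $\Pi=(\Pi_2,\Pi_1)$ be the joint distribution of $(T,S)$ obtained by drawing $T\sim W$ and then a uniformly random neighbour $S\in V_1$ of $T$. $(G_{samp},W)$ is an *$(\alpha,\delta)$ sampler* if for every $f:V_1\to[0,1]$, $$\Pr_{T\sim \Pi_2}\Big[\big|\mathbb E_{S\sim(\Pi_1|\Pi_2=T)}[f(S)]-\mathbb E_{S\sim\Pi_1}[f(S)]\big|\ge\alpha\Big]\le\delta .$$ The *two-step walk graph* of $G_{samp}$ is the weighted graph $G$ on $V_2$ (self-loops allowed) with edge weights $$w_{u_1,u_2}=\sum_{S\in V_1}\Pi_1(S)\,\Pr[\Pi_2=u_1\mid\Pi_1=S]\,\Pr[\Pi_2=u_2\mid\Pi_1=S].$$ In a weighted graph with vertex set $V$, the weight of a vertex is $w_v=\sum_u w_{v,u}$, and $\mu_G(A)=\sum_{v\in A}w_v/\sum_{v\in V}w_v$ for $A\subseteq V$. $\lambda(G)$ is the second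 largest, in absolute value and with multiplicity, of the eigenvalues of the matrix with entries $w_{u,v}/\sqrt{w_uw_v}$ (read as $0$ if $w_uw_v=0$); $\lambda(G)=0$ if $G$ has fewer than two vertices. The induced graph $G_B$ on a vertex set $B$ keeps the edge weights inside $B$, and its vertex weights are the sums of these. **Theorem 2.7 (every sampler contains an induced expander).** Let $\alpha,\beta,\delta\in(0,1)$ be such that $\alpha,\delta<\beta^2/100$. Let $(G_{samp},W)$ be an $(\alpha,\delta)$ sampler and let $G$ be its two-step walk graph. Let $A\subseteq V_2$ be any set with $\mu_G(A)\ge\beta$. Then there is a set $B\subseteq A$ such that $\mu_G(B)\ge\beta/4$ and $\lambda(G_B)\le 99/100$. Furthermore, such a set $B$ can be found in time polynomial in $|V_2|$: there are a single program $P$ of a real random access machine (index arithmetic, exact real $+,-,\times,/$, copying, and comparisons cost one step each; the only constants are natural and rational numbers; no rounding) and a polynomial $p$ such that for all $\alpha,\beta,\delta,(G_{samp},W),A$ as above and every numbering of $V_2$, the program $P$, given $|V_2|$, the edge weights of $G$ and the set $A$, halts after at most $p(|V_2|)$ steps with such a set $B$ as its output. -/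

import Mathlib

universe u v

noncomputable section

namespace InducedExpander

/-! ## Weighted graphs -/

/-- A weighted undirected graph on `V`, self-loops allowed.  Non-edges have weight zero, so the graph
is recorded by its symmetric non-negative weight function; `weight u v` is the weight of the edge
`(u, v)`. -/
structure WeightedGraph (V : Type*) where
  weight : V → V → ℝ
  symm : ∀ u v, weight u v = weight v u
  nonneg : ∀ u v, 0 ≤ weight u v

namespace WeightedGraph

variable {V : Type*}

/-- The weight of a vertex: the total weight of the edges at it. -/
def vertexWeight [Fintype V] (G : WeightedGraph V) (v : V) : ℝ := ∑ u, G.weight v u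

/-- The distribution on vertices induced by the edge weights, evaluated on a set of vertices. -/
def measure [Fintype V] (G : WeightedGraph V) (A : Finset V) : ℝ :=
  (∑ v ∈ A, G.vertexWeight v) / ∑ v, G.vertexWeight v

/-- The subgraph induced on `B`, with the same edge weights.  (Its vertex weights are then
recomputed inside `B`.) -/
def induce (G : WeightedGraph V) (B : Finset V) : WeightedGraph B where
  weight u v := G.weight u v
  symm u v := G.symm u v
  nonneg u v := G.nonneg u v

/-- The normalized adjacency matrix `w_{u,v} / √(w_u w_v)`.  The row and the column of a vertex of
weight zero are zero. -/
def normAdj [Fintype V] (G : WeightedGraph V) : Matrix V V ℝ :=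
  Matrix.of fun u v => G.weight u v / √(G.vertexWeight u * G.vertexWeight v)

theorem normAdj_isHermitian [Fintype V] (G : WeightedGraph V) : G.normAdj.IsHermitian := by
  ext u v
  simp [normAdj, G.symm u v, mul_comm]

open Classical in
/-- The second largest eigenvalue, in absolute value, of the normalized adjacency matrix: the
absolute values of the eigenvalues, with multiplicity, are listed in decreasing order, and the second
entry is taken.  It is `0` for a graph with fewer than two vertices. -/
def lam [Fintype V] (G : WeightedGraph V) : ℝ :=
  ((Finset.univ.val.map fun i => |G.normAdj_isHermitian.eigenvalues i|).sort (· ≥ ·)).getD 1 0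

end WeightedGraph

/-! ## Samplers and the two-step walk -/

/-- A finite bipartite graph `(V₂, V₁, E)` with a probability distribution `W` on `V₂`.  A vertex that
is drawn with positive probability has a neighbour, so that a random neighbour can be chosen. -/
structure BipartiteDist (V₂ V₁ : Type*) [Fintype V₂] where
  Adj : V₂ → V₁ → Prop
  W : V₂ → ℝ
  W_mem : W ∈ stdSimplex ℝ V₂
  exists_adj : ∀ t, W t ≠ 0 → ∃ s, Adj t s

namespace BipartiteDist

variable {V₂ V₁ : Type*} [Fintype V₂] [Fintype V₁]

open Classical in
/-- `(Π₁ | Π₂ = t)`: the uniform distribution on the neighbours of `t`. -/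
def nbr (X : BipartiteDist V₂ V₁) (t : V₂) (s : V₁) : ℝ :=
  if X.Adj t s then 1 / (Finset.univ.filter (X.Adj t)).card else 0

/-- The joint distribution `Π`: draw `t` from `W`, then a uniformly random neighbour `s` of `t`. -/
def joint (X : BipartiteDist V₂ V₁) (t : V₂) (s : V₁) : ℝ := X.W t * X.nbr t s

/-- The marginal distribution `Π₁` on `V₁`. -/
def marg₁ (X : BipartiteDist V₂ V₁) (s : V₁) : ℝ := ∑ t, X.joint t s

/-- `(Π₂ | Π₁ = s)`, the conditional distribution on `V₂` (zero if `s` has probability zero). -/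
def cond₂ (X : BipartiteDist V₂ V₁) (s : V₁) (t : V₂) : ℝ := X.joint t s / X.marg₁ s

open Classical in
/-- `(G, W)` is an `(α, δ)` sampler: for every `f : V₁ → [0,1]`, with probability at most `δ` over `t`
drawn from `W`, the mean of `f` over the neighbours of `t` is at distance at least `α` from the mean
of `f` under `Π₁`. -/
def IsSampler (X : BipartiteDist V₂ V₁) (α δ : ℝ) : Prop :=
  ∀ f : V₁ → ℝ, (∀ s, f s ∈ Set.Icc (0 : ℝ) 1) →
    ∑ t ∈ Finset.univ.filter
      (fun t => α ≤ |(∑ s, X.nbr t s * f s) - ∑ s, X.marg₁ s * f s|), X.W t ≤ δ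

theorem joint_nonneg (X : BipartiteDist V₂ V₁) (t : V₂) (s : V₁) : 0 ≤ X.joint t s := by
  unfold joint nbr
  refine mul_nonneg (X.W_mem.1 t) ?_
  split_ifs
  · positivity
  · exact le_rfl

theorem marg₁_nonneg (X : BipartiteDist V₂ V₁) (s : V₁) : 0 ≤ X.marg₁ s :=
  Finset.sum_nonneg fun t _ => X.joint_nonneg t s

theorem cond₂_nonneg (X : BipartiteDist V₂ V₁) (s : V₁) (t : V₂) : 0 ≤ X.cond₂ s t :=
  div_nonneg (X.joint_nonneg t s) (X.marg₁_nonneg s)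

/-- The two-step walk graph on `V₂`: draw `s` from `Π₁` and then two independent vertices from
`(Π₂ | Π₁ = s)`; the weight of `(u₁, u₂)` is the probability of obtaining `u₁` and then `u₂`. -/
def twoStep (X : BipartiteDist V₂ V₁) : WeightedGraph V₂ where
  weight u₁ u₂ := ∑ s, X.marg₁ s * (X.cond₂ s u₁ * X.cond₂ s u₂)
  symm u₁ u₂ := Finset.sum_congr rfl fun s _ => by rw [mul_comm (X.cond₂ s u₁)]
  nonneg u₁ u₂ := Finset.sum_nonneg fun s _ =>
    mul_nonneg (X.marg₁_nonneg s) (mul_nonneg (X.cond₂_nonneg s u₁) (X.cond₂_nonneg s u₂))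

end BipartiteDist

/-! ## The real random access machine

Countably many index registers hold natural numbers, and countably many doubly indexed arrays hold
real numbers.  One step is one addition or truncated subtraction of index registers, one arithmetic
operation on reals, one assignment, or one comparison.  Reals cannot be rounded or turned into
indices, and the only constants are natural numbers (in index registers) and rational numbers. -/

/-- A memory state. -/
structure State where
  /-- the index registers -/
  idx : ℕ → ℕ
  /-- `arr a i j` is the entry `(i, j)` of array `a` -/
  arr : ℕ → ℕ → ℕ → ℝ

/-- A reference to a real cell: array number `a`, at the row and the column held by the index
registers `i` and `j`. -/
structure Ref where
  a : ℕ
  i : ℕ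
  j : ℕ

namespace State

/-- The real number in the cell that `r` refers to. -/
def get (σ : State) (r : Ref) : ℝ := σ.arr r.a (σ.idx r.i) (σ.idx r.j)

/-- Write `x` to index register `k`. -/
def setIdx (σ : State) (k x : ℕ) : State where
  idx := fun l => if l = k then x else σ.idx l
  arr := σ.arr

/-- Write `x` to the cell that `r` refers to. -/
def set (σ : State) (r : Ref) (x : ℝ) : State where
  idx := σ.idx
  arr := fun a i j => if a = r.a ∧ i = σ.idx r.i ∧ j = σ.idx r.j then x else σ.arr a i j

end State

/-- The instructions; the first argument is the target. -/
inductive Instr where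
  | nop
  | idxConst (k c : ℕ)
  | idxAdd (k l m : ℕ)
  | idxSub (k l m : ℕ)
  | const (r : Ref) (q : ℚ)
  | copy (r x : Ref)
  | add (r x y : Ref)
  | sub (r x y : Ref)
  | mul (r x y : Ref)
  | div (r x y : Ref)

/-- The effect of an instruction; dividing by zero gives zero. -/
def Instr.apply : Instr → State → State
  | nop, σ => σ
  | idxConst k c, σ => σ.setIdx k c
  | idxAdd k l m, σ => σ.setIdx k (σ.idx l + σ.idx m)
  | idxSub k l m, σ => σ.setIdx k (σ.idx l - σ.idx m)
  | const r q, σ => σ.set r q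
  | copy r x, σ => σ.set r (σ.get x)
  | add r x y, σ => σ.set r (σ.get x + σ.get y)
  | sub r x y, σ => σ.set r (σ.get x - σ.get y)
  | mul r x y, σ => σ.set r (σ.get x * σ.get y)
  | div r x y, σ => σ.set r (σ.get x / σ.get y)

/-- The comparisons on which a program can branch. -/
inductive Test where
  | idxLt (k l : ℕ)
  | realLe (x y : Ref)

/-- The comparison succeeds. -/
def Test.Holds : Test → State → Prop
  | idxLt k l, σ => σ.idx k < σ.idx l
  | realLe x y, σ => σ.get x ≤ σ.get y

/-- Programs. -/
inductive Prog where
  | instr (c : Instr)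
  | seq (P Q : Prog)
  | ite (b : Test) (P Q : Prog)
  | loop (b : Test) (P : Prog)

/-- `Exec P σ t τ`: started in the state `σ`, the program `P` halts after exactly `t` steps in the
state `τ`.  Each instruction and each evaluation of a comparison is one step. -/
inductive Exec : Prog → State → ℕ → State → Prop
  | instr (c : Instr) (σ : State) : Exec (.instr c) σ 1 (c.apply σ)
  | seq {P Q : Prog} {σ τ ρ : State} {t u : ℕ} :
      Exec P σ t τ → Exec Q τ u ρ → Exec (.seq P Q) σ (t + u) ρ
  | ite_true {b : Test} {P Q : Prog} {σ τ : State} {t : ℕ} :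
      b.Holds σ → Exec P σ t τ → Exec (.ite b P Q) σ (1 + t) τ
  | ite_false {b : Test} {P Q : Prog} {σ τ : State} {t : ℕ} :
      ¬ b.Holds σ → Exec Q σ t τ → Exec (.ite b P Q) σ (1 + t) τ
  | loop_true {b : Test} {P : Prog} {σ τ ρ : State} {t u : ℕ} :
      b.Holds σ → Exec P σ t τ → Exec (.loop b P) τ u ρ → Exec (.loop b P) σ (1 + t + u) ρ
  | loop_false {b : Test} {P : Prog} {σ : State} :
      ¬ b.Holds σ → Exec (.loop b P) σ 1 σ

/-- Programs are deterministic. -/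
theorem Exec.deterministic {P : Prog} {σ τ τ' : State} {t t' : ℕ}
    (h : Exec P σ t τ) (h' : Exec P σ t' τ') : t = t' ∧ τ = τ' := by
  induction h generalizing t' τ' with
  | instr c σ => cases h'; exact ⟨rfl, rfl⟩
  | seq _ _ ih₁ ih₂ =>
    cases h' with
    | seq k₁ k₂ =>
      obtain ⟨rfl, rfl⟩ := ih₁ k₁
      obtain ⟨rfl, rfl⟩ := ih₂ k₂
      exact ⟨rfl, rfl⟩
  | ite_true hb _ ih =>
    cases h' with
    | ite_true _ k => obtain ⟨rfl, rfl⟩ := ih k; exact ⟨rfl, rfl⟩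
    | ite_false hb' _ => exact absurd hb hb'
  | ite_false hb _ ih =>
    cases h' with
    | ite_true hb' _ => exact absurd hb' hb
    | ite_false _ k => obtain ⟨rfl, rfl⟩ := ih k; exact ⟨rfl, rfl⟩
  | loop_true hb _ _ ih₁ ih₂ =>
    cases h' with
    | loop_true _ k₁ k₂ =>
      obtain ⟨rfl, rfl⟩ := ih₁ k₁
      obtain ⟨rfl, rfl⟩ := ih₂ k₂
      exact ⟨rfl, rfl⟩
    | loop_false hb' => exact absurd hb hb'
  | loop_false hb =>
    cases h' with
    | loop_true hb' _ _ => exact absurd hb' hb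
    | loop_false _ => exact ⟨rfl, rfl⟩

open Classical in
/-- The input state for a weighted graph `G` whose vertices are numbered `0, …, n - 1` by `e`, and a
vertex set `A`: index register `0` holds `n`, array `0` holds the edge weights of `G`, column `0` of
array `1` holds the indicator function of `A`, and everything else is zero. -/
def inputState {V : Type*} {n : ℕ} (e : V ≃ Fin n) (G : WeightedGraph V) (A : Finset V) : State where
  idx := fun k => if k = 0 then n else 0
  arr := fun a i j =>
    if a = 0 then
      (if h : i < n ∧ j < n then G.weight (e.symm ⟨i, h.1⟩) (e.symm ⟨j, h.2⟩) else 0)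
    else if a = 1 ∧ j = 0 then
      (if h : i < n then (if e.symm ⟨i, h⟩ ∈ A then 1 else 0) else 0)
    else 0

open Classical in
/-- The state `τ` outputs the vertex set `B`: column `0` of array `1` holds its indicator function. -/
def Outputs {V : Type*} {n : ℕ} (e : V ≃ Fin n) (τ : State) (B : Finset V) : Prop :=
  ∀ v : V, τ.arr 1 (e v) 0 = if v ∈ B then 1 else 0

end InducedExpander

end

open InducedExpander

/-! Write W(S) for the weight of a vertex set S in the two-step graph and e(S,T) for the total edge
weight from S to T. For f(s) = Pr[Π₂ ∈ B | Π₁ = s] the sampler property says that e(R,B) is W(R)W(B)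
up to errors governed by α and δ (`IsSampler.edgeWeight_bounds`). Start from B = A and, while a cut
(S, B∖S) is found with 2e(S,B∖S) below both e(S,S) and e(B∖S,B∖S), discard its lighter side. The
removed part R = A∖B then satisfies 2e(R,B) ≤ e(R,R), so roughly 2W(R)(W(A)−W(R)) ≤ W(R)²: either R
is very light or it has about two thirds of W(A). One removal takes at most half of B and cannot
jump this gap, so W(R) ≤ W(A)/20 forever (`light_of_quadratic`, `IsSampler.isPruned_sdiff`).

If no cut of B were sparse, all conductances would be at least 1/3, and Cheeger's inequality would
bound the second eigenvalue by 1 − (1/3)²/2 = 17/18; absolute values do not matter because the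
two-step weights form a Gram matrix. But not all cuts can be tried, and exact rational arithmetic
does not yield eigenvectors. Instead only the sweep cuts of the columns of P^(100n) are tried, P
being the walk matrix of the graph on B. For one column, Cheeger's argument bounds a variance by a
Dirichlet form (`variance_le_of_no_sparse_sweep`); summed over the columns this reads ∑ λ^K (18λ −
17) ≤ 1 with K = 200n. The eigenvalue 1 uses up the right side, and a further eigenvalue above
99/100 would contribute more than the eigenvalues below 17/18 can cancel
(`lam_le_of_no_sparse_sweep`).

A round over all columns either finds no sparse cut or shrinks B, so n rounds suffice
(`searchCmd_spec`). Polynomial running time comes from a small calculus of expressions and commands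
closed under sums and loops over n. -/

namespace InducedExpander

/-! ### Expressions and commands that compile to programs -/

/-- The contents of all arrays of a memory state. -/
abbrev Arrays := ℕ → ℕ → ℕ → ℝ

/-- Apply `F 0`, `F 1`, …, `F (n - 1)` in turn. -/
def countFold (F : ℕ → Arrays → Arrays) (A : Arrays) : ℕ → Arrays
  | 0 => A
  | n + 1 => F n (countFold F A n)

theorem countFold_induction {F : ℕ → Arrays → Arrays} {A : Arrays} (I : ℕ → Arrays → Prop)
    (h0 : I 0 A) (n : ℕ) (h : ∀ j < n, ∀ A, I j A → I (j + 1) (F j A)) :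
    I n (countFold F A n) := by
  induction n with
  | zero => exact h0
  | succ n ih => exact h n (by omega) _ (ih fun j hj => h j (by omega))

theorem countFold_const (f : Arrays → Arrays) (A : Arrays) (n : ℕ) :
    countFold (fun _ => f) A n = f^[n] A := by
  induction n with
  | zero => rfl
  | succ n ih => rw [countFold, ih, Function.iterate_succ_apply']

/-- `τ` has the same index registers below `d` and the same arrays below `m` as `σ`. -/
structure AgreeBelow (d m : ℕ) (σ τ : State) : Prop where
  idx : ∀ r < d, τ.idx r = σ.idx r
  arr : ∀ a < m, τ.arr a = σ.arr a

theorem AgreeBelow.refl (d m : ℕ) (σ : State) : AgreeBelow d m σ σ :=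
  ⟨fun _ _ => rfl, fun _ _ => rfl⟩

theorem AgreeBelow.trans {d m : ℕ} {σ τ ρ : State} (h : AgreeBelow d m σ τ)
    (h' : AgreeBelow d m τ ρ) : AgreeBelow d m σ ρ :=
  ⟨fun r hr => (h'.idx r hr).trans (h.idx r hr), fun a ha => (h'.arr a ha).trans (h.arr a ha)⟩

theorem AgreeBelow.mono {d d' m m' : ℕ} {σ τ : State} (h : AgreeBelow d m σ τ)
    (hd : d' ≤ d) (hm : m' ≤ m) : AgreeBelow d' m' σ τ :=
  ⟨fun r hr => h.idx r (hr.trans_le hd), fun a ha => h.arr a (ha.trans_le hm)⟩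

theorem AgreeBelow.set {d m : ℕ} {σ τ : State} (h : AgreeBelow d m σ τ) (r : Ref) (x : ℝ)
    (hr : m ≤ r.a) : AgreeBelow d m σ (τ.set r x) := by
  refine ⟨h.idx, fun a ha => ?_⟩
  rw [← h.arr a ha]
  funext i j
  have : a ≠ r.a := by omega
  simp [State.set, this]

theorem AgreeBelow.setIdx {d m : ℕ} {σ τ : State} (h : AgreeBelow d m σ τ) (k x : ℕ)
    (hk : d ≤ k) : AgreeBelow d m σ (τ.setIdx k x) := by
  refine ⟨fun r hr => ?_, h.arr⟩
  have : r ≠ k := by omega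
  simpa [State.setIdx, this] using h.idx r hr

theorem State.setIdx_idx (σ : State) (k x : ℕ) :
    (σ.setIdx k x).idx = Function.update σ.idx k x := by
  funext l
  simp [State.setIdx, Function.update_apply]

/-- The loop that runs `body` with register `k` holding `0, …, n - 1`, where register `0` holds `n`
and register `1` holds `1`. -/
def Prog.count (k : ℕ) (body : Prog) : Prog :=
  .seq (.instr (.idxConst k 0))
    (.loop (.idxLt k 0) (.seq body (.instr (.idxAdd k k 1))))

theorem exec_loop {body : Prog} {k n T : ℕ} (I : ℕ → State → Prop)
    (hI : ∀ j σ, I j σ → σ.idx k = j ∧ σ.idx 0 = n)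
    (h : ∀ j < n, ∀ σ, I j σ → ∃ t τ, Exec body σ t τ ∧ t ≤ T ∧ I (j + 1) τ)
    (m j : ℕ) (hm : j + m = n) (σ : State) (hσ : I j σ) :
    ∃ t τ, Exec (.loop (.idxLt k 0) body) σ t τ ∧ t ≤ m * (T + 1) + 1 ∧ I n τ := by
  induction m generalizing j σ with
  | zero =>
    obtain rfl : j = n := by omega
    obtain ⟨h1, h2⟩ := hI _ _ hσ
    exact ⟨1, σ, .loop_false (by simp [Test.Holds, h1, h2]), by omega, hσ⟩
  | succ m ih =>
    obtain ⟨h1, h2⟩ := hI _ _ hσ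
    obtain ⟨t, τ, hE, ht, hτ⟩ := h j (by omega) σ hσ
    obtain ⟨t', ρ, hE', ht', hρ⟩ := ih (j + 1) (by omega) τ hτ
    refine ⟨1 + t + t', ρ, .loop_true (by simp only [Test.Holds]; omega) hE hE', ?_, hρ⟩
    rw [add_mul]
    omega

/-- The invariant is read with the counter already stored in register `k`. A round costs a test, the
body and an increment; initialisation and the final failing test give the extra 2. -/
theorem exec_count {body : Prog} {k n T : ℕ} (hk : 2 ≤ k) (I : ℕ → State → Prop)
    (h : ∀ j < n, ∀ σ, I j σ → σ.idx k = j → σ.idx 0 = n → σ.idx 1 = 1 →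
      ∃ t τ, Exec body σ t τ ∧ t ≤ T ∧ τ.idx k = j ∧ τ.idx 0 = n ∧ τ.idx 1 = 1 ∧
        I (j + 1) (τ.setIdx k (j + 1)))
    (σ : State) (h0 : σ.idx 0 = n) (h1 : σ.idx 1 = 1) (hσ : I 0 (σ.setIdx k 0)) :
    ∃ t τ, Exec (Prog.count k body) σ t τ ∧ t ≤ n * (T + 2) + 2 ∧ I n τ := by
  have hk0 : (0 : ℕ) ≠ k := by omega
  have hk1 : (1 : ℕ) ≠ k := by omega
  obtain ⟨t, τ, hE, ht, hτ⟩ := exec_loop (body := .seq body (.instr (.idxAdd k k 1)))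
    (k := k) (n := n) (T := T + 1)
    (fun j σ => I j σ ∧ σ.idx k = j ∧ σ.idx 0 = n ∧ σ.idx 1 = 1)
    (fun j σ h => ⟨h.2.1, h.2.2.1⟩)
    (fun j hj σ hσ => by
      obtain ⟨t, τ, hE, ht, hk', h0', h1', hI⟩ := h j hj σ hσ.1 hσ.2.1 hσ.2.2.1 hσ.2.2.2
      refine ⟨t + 1, _, .seq hE (.instr _ _), by omega, ?_⟩
      simp only [Instr.apply, hk', h1']
      exact ⟨hI, by simp [State.setIdx], by simp [State.setIdx, hk0, h0'],
        by simp [State.setIdx, hk1, h1']⟩)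
    n 0 (by omega) (σ.setIdx k 0)
    ⟨hσ, by simp [State.setIdx], by simp [State.setIdx, hk0, h0], by simp [State.setIdx, hk1, h1]⟩
  exact ⟨1 + t, τ, .seq (.instr _ _) hE, by linarith, hτ.1⟩

/-- The cell `(0, 0)` of array `s`, provided that register `2` holds `0`. -/
def slot (s : ℕ) : Ref := ⟨s, 2, 2⟩

/-- Some program evaluates `f` in polynomially many steps.  The value depends on index registers
below `d` and arrays below `3` only; it is written to a given array `s ≥ 3`, and index registers below
`d` and arrays below `s` are kept. -/
def ExprComputable (d : ℕ) (f : (ℕ → ℕ) → Arrays → ℝ) : Prop :=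
  ∀ s, 3 ≤ d → 3 ≤ s → ∃ (P : Prog) (p : Polynomial ℕ), ∀ σ₀ σ : State,
    σ₀.idx 1 = 1 → σ₀.idx 2 = 0 → AgreeBelow d 3 σ₀ σ →
    ∃ t τ, Exec P σ t τ ∧ t ≤ p.eval (σ₀.idx 0) ∧ AgreeBelow d s σ τ ∧
      τ.arr s 0 0 = f σ₀.idx σ₀.arr

/-- Some program replaces the contents of the arrays below `3` by those of `F` in polynomially many
steps, keeping the index registers below `d`. -/
def CmdComputable (d : ℕ) (F : (ℕ → ℕ) → Arrays → Arrays) : Prop :=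
  3 ≤ d → ∃ (P : Prog) (p : Polynomial ℕ), ∀ σ₀ σ : State,
    σ₀.idx 1 = 1 → σ₀.idx 2 = 0 → AgreeBelow d 3 σ₀ σ →
    ∃ t τ, Exec P σ t τ ∧ t ≤ p.eval (σ₀.idx 0) ∧ (∀ r < d, τ.idx r = σ.idx r) ∧
      ∀ a < 3, τ.arr a = F σ₀.idx σ₀.arr a

/-! ### Evaluating real expressions in polynomial time -/

namespace ExprComputable

variable {d : ℕ} {f g : (ℕ → ℕ) → Arrays → ℝ}

theorem cell (a i j : ℕ) (ha : a < 3) (hi : i < d) (hj : j < d) :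
    ExprComputable d fun ρ A => A a (ρ i) (ρ j) := by
  intro s hd hs
  refine ⟨.instr (.copy (slot s) ⟨a, i, j⟩), 1, fun σ₀ σ h1 h2 h => ⟨1, _, .instr _ _, by simp,
    (AgreeBelow.refl _ _ _).set _ _ le_rfl, ?_⟩⟩
  have h2' : σ.idx 2 = 0 := by rw [h.idx 2 (by omega), h2]
  simp [Instr.apply, State.set, State.get, slot, h2', h.idx i hi, h.idx j hj, h.arr a ha]

theorem cell_zero (a i : ℕ) (ha : a < 3) (hi : i < d) :
    ExprComputable d fun ρ A => A a (ρ i) 0 := by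
  intro s hd hs
  refine ⟨.instr (.copy (slot s) ⟨a, i, 2⟩), 1, fun σ₀ σ h1 h2 h => ⟨1, _, .instr _ _, by simp,
    (AgreeBelow.refl _ _ _).set _ _ le_rfl, ?_⟩⟩
  have h2' : σ.idx 2 = 0 := by rw [h.idx 2 (by omega), h2]
  simp [Instr.apply, State.set, State.get, slot, h2', h.idx i hi, h.arr a ha]

theorem const (q : ℚ) : ExprComputable d fun _ _ => (q : ℝ) := by
  intro s hd hs
  refine ⟨.instr (.const (slot s) q), 1, fun σ₀ σ h1 h2 h => ⟨1, _, .instr _ _, by simp,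
    (AgreeBelow.refl _ _ _).set _ _ le_rfl, ?_⟩⟩
  have h2' : σ.idx 2 = 0 := by rw [h.idx 2 (by omega), h2]
  simp [Instr.apply, State.set, slot, h2']

theorem zero : ExprComputable d fun _ _ => (0 : ℝ) := by
  simpa using const (d := d) 0

theorem one : ExprComputable d fun _ _ => (1 : ℝ) := by
  simpa using const (d := d) 1

/-- Two expressions can be evaluated into consecutive arrays. -/
theorem pair (hf : ExprComputable d f) (hg : ExprComputable d g) (s : ℕ) (hd : 3 ≤ d)
    (hs : 3 ≤ s) : ∃ (P : Prog) (p : Polynomial ℕ), ∀ σ₀ σ : State,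
      σ₀.idx 1 = 1 → σ₀.idx 2 = 0 → AgreeBelow d 3 σ₀ σ →
      ∃ t τ, Exec P σ t τ ∧ t ≤ p.eval (σ₀.idx 0) ∧ AgreeBelow d s σ τ ∧ τ.idx 2 = 0 ∧
        τ.arr s 0 0 = f σ₀.idx σ₀.arr ∧ τ.arr (s + 1) 0 0 = g σ₀.idx σ₀.arr := by
  obtain ⟨P, p, hP⟩ := hf s hd hs
  obtain ⟨Q, q, hQ⟩ := hg (s + 1) hd (by omega)
  -- `Q` writes to array `s + 1` and keeps everything below it, so the value left by `P` in array
  -- `s` survives.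
  refine ⟨.seq P Q, p + q, fun σ₀ σ h1 h2 h => ?_⟩
  obtain ⟨t, τ, hE, ht, hA, hv⟩ := hP σ₀ σ h1 h2 h
  obtain ⟨t', τ', hE', ht', hA', hv'⟩ := hQ σ₀ τ h1 h2 (h.trans (hA.mono le_rfl hs))
  refine ⟨t + t', τ', .seq hE hE', by rw [Polynomial.eval_add]; omega,
    hA.trans (hA'.mono le_rfl (by omega)), ?_, ?_, hv'⟩
  · rw [hA'.idx 2 (by omega), hA.idx 2 (by omega), h.idx 2 (by omega), h2]
  · rw [hA'.arr s (by omega), hv]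

theorem binary (hf : ExprComputable d f) (hg : ExprComputable d g) (c : Ref → Ref → Ref → Instr)
    (op : ℝ → ℝ → ℝ) (hc : ∀ r x y σ, (c r x y).apply σ = σ.set r (op (σ.get x) (σ.get y))) :
    ExprComputable d fun ρ A => op (f ρ A) (g ρ A) := by
  intro s hd hs
  obtain ⟨P, p, hP⟩ := pair hf hg s hd hs
  refine ⟨.seq P (.instr (c (slot s) (slot s) (slot (s + 1)))), p + 1, fun σ₀ σ h1 h2 h => ?_⟩
  obtain ⟨t, τ, hE, ht, hA, hz, hv, hv'⟩ := hP σ₀ σ h1 h2 h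
  refine ⟨t + 1, _, .seq hE (.instr _ _), by simpa using ht, ?_, ?_⟩
  · rw [hc]
    exact hA.set _ _ le_rfl
  · rw [hc]
    simp [State.set, State.get, slot, hz, hv, hv']

theorem add (hf : ExprComputable d f) (hg : ExprComputable d g) :
    ExprComputable d fun ρ A => f ρ A + g ρ A :=
  binary hf hg .add (· + ·) fun _ _ _ _ => rfl

theorem sub (hf : ExprComputable d f) (hg : ExprComputable d g) :
    ExprComputable d fun ρ A => f ρ A - g ρ A :=
  binary hf hg .sub (· - ·) fun _ _ _ _ => rfl

theorem mul (hf : ExprComputable d f) (hg : ExprComputable d g) :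
    ExprComputable d fun ρ A => f ρ A * g ρ A :=
  binary hf hg .mul (· * ·) fun _ _ _ _ => rfl

theorem div (hf : ExprComputable d f) (hg : ExprComputable d g) :
    ExprComputable d fun ρ A => f ρ A / g ρ A :=
  binary hf hg .div (· / ·) fun _ _ _ _ => rfl

theorem ite_test {f₁ f₂ : (ℕ → ℕ) → Arrays → ℝ} (b : Test) (c : (ℕ → ℕ) → Arrays → Prop)
    [∀ ρ A, Decidable (c ρ A)]
    (hf₁ : ExprComputable d f₁) (hf₂ : ExprComputable d f₂) (s : ℕ) (hd : 3 ≤ d) (hs : 3 ≤ s) :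
    ∃ (P : Prog) (p : Polynomial ℕ), ∀ σ₀ σ : State,
      σ₀.idx 1 = 1 → σ₀.idx 2 = 0 → AgreeBelow d 3 σ₀ σ →
      (b.Holds σ ↔ c σ₀.idx σ₀.arr) →
      ∃ t τ, Exec P σ t τ ∧ t ≤ p.eval (σ₀.idx 0) ∧ AgreeBelow d s σ τ ∧
        τ.arr s 0 0 = if c σ₀.idx σ₀.arr then f₁ σ₀.idx σ₀.arr else f₂ σ₀.idx σ₀.arr := by
  obtain ⟨P, p, hP⟩ := hf₁ s hd hs
  obtain ⟨Q, q, hQ⟩ := hf₂ s hd hs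
  refine ⟨.ite b P Q, 1 + p + q, fun σ₀ σ h1 h2 h hb => ?_⟩
  by_cases hc : c σ₀.idx σ₀.arr
  · obtain ⟨t, τ, hE, ht, hA, hv⟩ := hP σ₀ σ h1 h2 h
    exact ⟨1 + t, τ, .ite_true (hb.2 hc) hE,
      by simp only [Polynomial.eval_add, Polynomial.eval_one]; omega, hA, by rw [hv, if_pos hc]⟩
  · obtain ⟨t, τ, hE, ht, hA, hv⟩ := hQ σ₀ σ h1 h2 h
    exact ⟨1 + t, τ, .ite_false (fun h => hc (hb.1 h)) hE,
      by simp only [Polynomial.eval_add, Polynomial.eval_one]; omega, hA, by rw [hv, if_neg hc]⟩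

theorem iteLt {f₁ f₂ : (ℕ → ℕ) → Arrays → ℝ} (k l : ℕ) (hk : k < d) (hl : l < d)
    (hf₁ : ExprComputable d f₁) (hf₂ : ExprComputable d f₂) :
    ExprComputable d fun ρ A => if ρ k < ρ l then f₁ ρ A else f₂ ρ A := by
  intro s hd hs
  obtain ⟨P, p, hP⟩ := ite_test (.idxLt k l) (fun ρ _ => ρ k < ρ l) hf₁ hf₂ s hd hs
  exact ⟨P, p, fun σ₀ σ h1 h2 h => hP σ₀ σ h1 h2 h
    (by simp only [Test.Holds, h.idx k hk, h.idx l hl])⟩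

theorem iteLe {f₁ f₂ : (ℕ → ℕ) → Arrays → ℝ} (hf : ExprComputable d f) (hg : ExprComputable d g)
    (hf₁ : ExprComputable d f₁) (hf₂ : ExprComputable d f₂) :
    ExprComputable d fun ρ A => if f ρ A ≤ g ρ A then f₁ ρ A else f₂ ρ A := by
  intro s hd hs
  obtain ⟨P, p, hP⟩ := pair hf hg s hd hs
  obtain ⟨Q, q, hQ⟩ := ite_test (.realLe (slot s) (slot (s + 1)))
    (fun ρ A => f ρ A ≤ g ρ A) hf₁ hf₂ s hd hs
  refine ⟨.seq P Q, p + q, fun σ₀ σ h1 h2 h => ?_⟩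
  obtain ⟨t, τ, hE, ht, hA, hz, hv, hv'⟩ := hP σ₀ σ h1 h2 h
  obtain ⟨t', τ', hE', ht', hA', hw⟩ := hQ σ₀ τ h1 h2 (h.trans (hA.mono le_rfl hs))
    (by simp only [Test.Holds, State.get, slot, hz, hv, hv'])
  exact ⟨t + t', τ', .seq hE hE', by rw [Polynomial.eval_add]; omega, hA.trans hA', hw⟩

/-- The summation index lives in register `d`, the partial sum in array `s` and the current summand
in array `s + 1`. Registers and arrays thus serve as stacks, and sums can be nested. -/
theorem sum (hf : ExprComputable (d + 1) f) :
    ExprComputable d fun ρ A =>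
      ∑ j ∈ Finset.range (ρ 0), f (Function.update ρ d j) A := by
  intro s hd hs
  have hd0 : (0 : ℕ) ≠ d := by omega
  have hd1 : (1 : ℕ) ≠ d := by omega
  have hd2 : (2 : ℕ) ≠ d := by omega
  obtain ⟨P, p, hP⟩ := hf (s + 1) (by omega) (by omega)
  refine ⟨.seq (.instr (.const (slot s) 0))
    (.count d (.seq P (.instr (.add (slot s) (slot s) (slot (s + 1)))))),
    1 + (Polynomial.X * (p + 1 + 2) + 2), fun σ₀ σ h1 h2 h => ?_⟩
  have hz : σ.idx 2 = 0 := by rw [h.idx 2 (by omega), h2]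
  obtain ⟨t, τ, hE, ht, hA, hv⟩ := exec_count
    (body := .seq P (.instr (.add (slot s) (slot s) (slot (s + 1))))) (k := d) (n := σ₀.idx 0)
    (T := p.eval (σ₀.idx 0) + 1) (by omega)
    (fun j τ => AgreeBelow d s σ τ ∧
      τ.arr s 0 0 = ∑ i ∈ Finset.range j, f (Function.update σ₀.idx d i) σ₀.arr)
    (fun j hj τ hτ hk h0 hone => by
      obtain ⟨hA, hv⟩ := hτ
      obtain ⟨t, ρ, hE, ht, hA', hv'⟩ := hP (σ₀.setIdx d j) τ
        (by simpa [State.setIdx, hd1] using h1)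
        (by simpa [State.setIdx, hd2] using h2)
        ⟨fun r hr => by
          by_cases hrd : r = d
          · simp [State.setIdx, hrd, hk]
          · simp only [State.setIdx, hrd, if_false]
            rw [hA.idx r (by omega), h.idx r (by omega)],
        fun a ha => by rw [hA.arr a (by omega), h.arr a ha]; rfl⟩
      have hz' : ρ.idx 2 = 0 := by
        rw [hA'.idx 2 (by omega), hA.idx 2 (by omega), hz]
      refine ⟨t + 1, _, .seq hE (.instr _ _), ?_, ?_, ?_, ?_, ?_, ?_⟩
      · simpa [State.setIdx, hd0] using ht
      · simpa [Instr.apply, State.set, hk] using hA'.idx d (by omega)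
      · simpa [Instr.apply, State.set, h0] using hA'.idx 0 (by omega)
      · simpa [Instr.apply, State.set, hone] using hA'.idx 1 (by omega)
      · exact ((hA.trans (hA'.mono (by omega) (by omega))).set _ _ le_rfl).setIdx _ _ le_rfl
      · rw [Finset.sum_range_succ, ← hv]
        simp only [State.setIdx_idx] at hv'
        simp [Instr.apply, State.set, State.setIdx, State.get, slot, hz', hv', hA'.arr s (by omega)])
    (σ.set (slot s) 0) (by simpa [State.set] using h.idx 0 (by omega))
    (by simpa [State.set, h1] using h.idx 1 (by omega))
    ⟨((AgreeBelow.refl d s σ).set (slot s) 0 le_rfl).setIdx d 0 le_rfl, by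
      simp [State.set, State.setIdx, slot, hz]⟩
  refine ⟨1 + t, τ, .seq ?_ hE, ?_, hA, hv⟩
  · have := Exec.instr (.const (slot s) 0) σ
    simpa [Instr.apply] using this
  · simpa using ht

end ExprComputable

/-! ### Composing commands in polynomial time -/

namespace CmdComputable

variable {d : ℕ}

/-- A command may be replaced by one with the same effect. -/
theorem congr {F G : (ℕ → ℕ) → Arrays → Arrays} (hF : CmdComputable d F) (h : F = G) :
    CmdComputable d G := h ▸ hF

theorem seq {F G : (ℕ → ℕ) → Arrays → Arrays} (hF : CmdComputable d F) (hG : CmdComputable d G) :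
    CmdComputable d fun ρ A => G ρ (F ρ A) := by
  intro hd
  obtain ⟨P, p, hP⟩ := hF hd
  obtain ⟨Q, q, hQ⟩ := hG hd
  refine ⟨.seq P Q, p + q, fun σ₀ σ h1 h2 h => ?_⟩
  obtain ⟨t, τ, hE, ht, hI, hv⟩ := hP σ₀ σ h1 h2 h
  -- The reference state for `Q` carries the ideal result of `F`. The real state `τ` may differ from
  -- it in scratch registers and arrays, which agreement below `d` and 3 permits.
  obtain ⟨t', τ', hE', ht', hI', hv'⟩ := hQ ⟨σ₀.idx, F σ₀.idx σ₀.arr⟩ τ h1 h2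
    ⟨fun r hr => (hI r hr).trans (h.idx r hr), hv⟩
  exact ⟨t + t', τ', .seq hE hE', by rw [Polynomial.eval_add]; exact add_le_add ht ht',
    fun r hr => (hI' r hr).trans (hI r hr), hv'⟩

/-- The constant `m` is unrolled into the program text. -/
theorem iterate {F : (ℕ → ℕ) → Arrays → Arrays} (hF : CmdComputable d F) (m : ℕ) :
    CmdComputable d fun ρ A => (F ρ)^[m] A := by
  induction m with
  | zero =>
    exact fun _ => ⟨.instr .nop, 1, fun σ₀ σ _ _ h => ⟨1, σ, .instr .nop σ, by simp,
      fun _ _ => rfl, h.arr⟩⟩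
  | succ m ih => exact (hF.seq ih).congr (by simp [Function.iterate_succ])

theorem count {F : (ℕ → ℕ) → Arrays → Arrays} (hF : CmdComputable (d + 1) F) :
    CmdComputable d fun ρ A =>
      countFold (fun j => F (Function.update ρ d j)) A (ρ 0) := by
  intro hd
  have hd0 : (0 : ℕ) ≠ d := by omega
  have hd1 : (1 : ℕ) ≠ d := by omega
  have hd2 : (2 : ℕ) ≠ d := by omega
  obtain ⟨P, p, hP⟩ := hF (by omega)
  refine ⟨.count d P, Polynomial.X * (p + 2) + 2, fun σ₀ σ h1 h2 h => ?_⟩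
  obtain ⟨t, τ, hE, ht, hI, hv⟩ := exec_count (body := P) (k := d) (n := σ₀.idx 0)
    (T := p.eval (σ₀.idx 0)) (by omega)
    (fun j τ => (∀ r < d, τ.idx r = σ.idx r) ∧ ∀ a < 3, τ.arr a =
      countFold (fun j => F (Function.update σ₀.idx d j)) σ₀.arr j a)
    (fun j hj τ hτ hk h0 hone => by
      obtain ⟨hI, hv⟩ := hτ
      obtain ⟨t, ρ, hE, ht, hI', hv'⟩ := hP ⟨Function.update σ₀.idx d j,
          countFold (fun j => F (Function.update σ₀.idx d j)) σ₀.arr j⟩ τ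
        (by simpa [Function.update_apply, hd1] using h1)
        (by simpa [Function.update_apply, hd2] using h2)
        ⟨fun r hr => by
          by_cases hrd : r = d
          · simp [hrd, hk]
          · simp only [Function.update_apply, hrd, if_false]
            rw [hI r (by omega), h.idx r (by omega)], hv⟩
      refine ⟨t, ρ, hE, ?_, by rw [hI' d (by omega), hk], by rw [hI' 0 (by omega), h0],
        by rw [hI' 1 (by omega), hone], fun r hr => ?_, hv'⟩
      · simpa [Function.update_apply, hd0] using ht
      · simp only [State.setIdx, hr.ne, if_false]
        rw [hI' r (by omega), hI r hr])
    σ (h.idx 0 (by omega)) (by rw [h.idx 1 (by omega), h1])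
    ⟨fun r hr => by simp [State.setIdx, hr.ne], h.arr⟩
  exact ⟨t, τ, hE, by simpa using ht, hI, hv⟩

/-- Simultaneous assignment to the first `n` entries of column `0` of an array. -/
theorem vec {f : (ℕ → ℕ) → Arrays → ℝ} (a : ℕ) (ha : a < 3) (hf : ExprComputable (d + 1) f) :
    CmdComputable d fun ρ A => Function.update A a fun v j =>
      if v < ρ 0 ∧ j = 0 then f (Function.update ρ d v) A else A a v j := by
  intro hd
  have hd0 : (0 : ℕ) ≠ d := by omega
  have hd1 : (1 : ℕ) ≠ d := by omega
  have hd2 : (2 : ℕ) ≠ d := by omega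
  obtain ⟨P, p, hP⟩ := hf 4 (by omega) (by omega)
  -- The expression may read the very array that is assigned, so all values are first collected in
  -- array 3 and copied to `a` only afterwards.
  refine ⟨.seq (.count d (.seq P (.instr (.copy ⟨3, d, 2⟩ (slot 4)))))
    (.count d (.instr (.copy ⟨a, d, 2⟩ ⟨3, d, 2⟩))),
    (Polynomial.X * (p + 1 + 2) + 2) + (Polynomial.X * (1 + 2) + 2), fun σ₀ σ h1 h2 h => ?_⟩
  have hz : σ.idx 2 = 0 := by rw [h.idx 2 (by omega), h2]
  obtain ⟨t, τ, hE, ht, hA, hv⟩ := exec_count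
    (body := .seq P (.instr (.copy ⟨3, d, 2⟩ (slot 4)))) (k := d) (n := σ₀.idx 0)
    (T := p.eval (σ₀.idx 0) + 1) (by omega)
    (fun j τ => AgreeBelow d 3 σ τ ∧
      ∀ i < j, τ.arr 3 i 0 = f (Function.update σ₀.idx d i) σ₀.arr)
    (fun j hj τ hτ hk h0 hone => by
      obtain ⟨hA, hv⟩ := hτ
      obtain ⟨t, ρ, hE, ht, hA', hv'⟩ := hP (σ₀.setIdx d j) τ
        (by simpa [State.setIdx, hd1] using h1)
        (by simpa [State.setIdx, hd2] using h2)
        ⟨fun r hr => by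
          by_cases hrd : r = d
          · simp [State.setIdx, hrd, hk]
          · simp only [State.setIdx, hrd, if_false]
            rw [hA.idx r (by omega), h.idx r (by omega)],
        fun a ha => by rw [hA.arr a (by omega), h.arr a ha]; rfl⟩
      have hz' : ρ.idx 2 = 0 := by
        rw [hA'.idx 2 (by omega), hA.idx 2 (by omega), hz]
      have hkd : ρ.idx d = j := by rw [hA'.idx d (by omega), hk]
      refine ⟨t + 1, _, .seq hE (.instr _ _), ?_, ?_, ?_, ?_, ?_, ?_⟩
      · simpa [State.setIdx, hd0] using ht
      · simpa [Instr.apply, State.set, hk] using hkd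
      · simpa [Instr.apply, State.set, h0] using hA'.idx 0 (by omega)
      · simpa [Instr.apply, State.set, hone] using hA'.idx 1 (by omega)
      · exact ((hA.trans (hA'.mono (by omega) (by omega))).set _ _ le_rfl).setIdx _ _ le_rfl
      · intro i hi
        simp only [State.setIdx_idx] at hv'
        by_cases hij : i = j
        · subst hij
          simp [Instr.apply, State.set, State.setIdx, State.get, slot, hz', hkd, hv']
        · simp [Instr.apply, State.set, State.setIdx, hz', hkd, hij, hA'.arr 3 (by omega),
            hv i (by omega)])
    σ (h.idx 0 (by omega)) (by rw [h.idx 1 (by omega), h1])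
    ⟨(AgreeBelow.refl _ _ _).setIdx _ _ le_rfl, by simp⟩
  obtain ⟨t', τ', hE', ht', hI', hv', -⟩ := exec_count
    (body := .instr (.copy ⟨a, d, 2⟩ ⟨3, d, 2⟩)) (k := d) (n := σ₀.idx 0)
    (T := 1) (by omega)
    (fun j ρ => (∀ r < d, ρ.idx r = σ.idx r) ∧
      (∀ b < 3, ρ.arr b = Function.update σ₀.arr a (fun v k =>
        if v < j ∧ k = 0 then f (Function.update σ₀.idx d v) σ₀.arr else σ₀.arr a v k) b) ∧
      ρ.arr 3 = τ.arr 3)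
    (fun j hj ρ hρ hk h0 hone => by
      obtain ⟨hI, hv', h3⟩ := hρ
      have hz' : ρ.idx 2 = 0 := by rw [hI 2 (by omega), hz]
      refine ⟨1, _, .instr _ _, le_rfl, ?_, ?_, ?_, ?_, ?_, ?_⟩
      · simpa [Instr.apply, State.set] using hk
      · simpa [Instr.apply, State.set] using h0
      · simpa [Instr.apply, State.set] using hone
      · intro r hr
        simpa [Instr.apply, State.set, State.setIdx, hr.ne] using hI r hr
      · intro b hb
        funext i k
        by_cases hba : b = a
        · subst hba
          by_cases hc : i = j ∧ k = 0
          · obtain ⟨rfl, rfl⟩ := hc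
            simp [Instr.apply, State.set, State.setIdx, State.get, hz', hk, h3, hv i hj]
          · have h1 : (i < j + 1 ∧ k = 0) ↔ (i < j ∧ k = 0) := by omega
            simp only [Instr.apply, State.set, State.setIdx, State.get, hz', hk, hv' b hb, hc,
              and_false, if_false, Function.update_self, h1]
        · simp only [Instr.apply, State.set, State.setIdx, hba, false_and, if_false]
          rw [hv' b hb, Function.update_of_ne hba, Function.update_of_ne hba]
      · rw [← h3]
        funext i k
        simp [Instr.apply, State.set, State.setIdx, ha.ne'])
    τ (by rw [hA.idx 0 (by omega), h.idx 0 (by omega)])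
    (by rw [hA.idx 1 (by omega), h.idx 1 (by omega), h1])
    ⟨fun r hr => by simpa [State.setIdx, hr.ne] using hA.idx r hr, fun b hb => by
      simp [State.setIdx, hA.arr b hb, h.arr b hb], rfl⟩
  refine ⟨t + t', τ', .seq hE hE', ?_, hI', hv'⟩
  simpa using add_le_add ht ht'

end CmdComputable

/-! ### Sweep cuts and the Dirichlet form -/

open MeasureTheory in
theorem integrable_ite_Ioc (a b c : ℝ) :
    Integrable (fun t : ℝ => if a < t ∧ t ≤ b then c else 0) ∧
      ∫ t : ℝ, (if a < t ∧ t ≤ b then c else 0) = c * max (b - a) 0 := by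
  have h : (fun t : ℝ => if a < t ∧ t ≤ b then c else 0) =
      (Set.Ioc a b).indicator fun _ => c := by
    funext t
    simp [Set.indicator_apply, Set.mem_Ioc]
  rw [h]
  refine ⟨(integrable_indicator_iff measurableSet_Ioc).2 (integrableOn_const (by simp)), ?_⟩
  rw [integral_indicator_const c measurableSet_Ioc, Real.volume_real_Ioc, smul_eq_mul, mul_comm]

/-- Integrating an inequality between two combinations of indicator functions of intervals. -/
theorem sum_mul_length_le {ι κ : Type*} [Fintype ι] [Fintype κ] (a b c : ι → ℝ) (a' b' c' : κ → ℝ)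
    (h : ∀ t : ℝ, ∑ i, (if a i < t ∧ t ≤ b i then c i else 0) ≤
      ∑ k, (if a' k < t ∧ t ≤ b' k then c' k else 0)) :
    ∑ i, c i * max (b i - a i) 0 ≤ ∑ k, c' k * max (b' k - a' k) 0 := by
  have key := MeasureTheory.integral_mono
    (MeasureTheory.integrable_finsetSum Finset.univ
      fun i _ => (integrable_ite_Ioc (a i) (b i) (c i)).1)
    (MeasureTheory.integrable_finsetSum Finset.univ
      fun k _ => (integrable_ite_Ioc (a' k) (b' k) (c' k)).1) h
  rw [MeasureTheory.integral_finsetSum _ fun i _ => (integrable_ite_Ioc (a i) (b i) (c i)).1,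
    MeasureTheory.integral_finsetSum _ fun k _ => (integrable_ite_Ioc (a' k) (b' k) (c' k)).1]
    at key
  simpa only [fun i => (integrable_ite_Ioc (a i) (b i) (c i)).2,
    fun k => (integrable_ite_Ioc (a' k) (b' k) (c' k)).2] using key

/-- The median is the least value of `x` with at most half of the weight strictly above it. If more
than half were strictly below, the next smaller value would also qualify. -/
theorem exists_weighted_median {V : Type*} [Fintype V] [Nonempty V] (d x : V → ℝ)
    (hd : ∀ v, 0 ≤ d v) :
    ∃ m, 2 * ∑ v with m < x v, d v ≤ ∑ v, d v ∧ 2 * ∑ v with x v < m, d v ≤ ∑ v, d v := by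
  classical
  have hvol : 0 ≤ ∑ v, d v := Finset.sum_nonneg fun v _ => hd v
  let M := Finset.univ.filter fun u => 2 * ∑ v with x u < x v, d v ≤ ∑ v, d v
  have hM : M.Nonempty := by
    obtain ⟨u, -, hu⟩ := Finset.exists_max_image Finset.univ x Finset.univ_nonempty
    refine ⟨u, Finset.mem_filter.2 ⟨Finset.mem_univ _, ?_⟩⟩
    rw [Finset.sum_eq_zero]
    · simpa
    · intro v hv
      exact absurd (Finset.mem_filter.1 hv).2 (not_lt.2 (hu v (Finset.mem_univ _)))
  obtain ⟨u, huM, hu⟩ := Finset.exists_min_image M x hM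
  refine ⟨x u, (Finset.mem_filter.1 huM).2, ?_⟩
  by_contra! hcon
  have hne : (Finset.univ.filter fun v => x v < x u).Nonempty := by
    rw [Finset.nonempty_iff_ne_empty]
    intro h
    rw [h] at hcon
    simp at hcon
    linarith
  obtain ⟨v, hv, hmax⟩ := Finset.exists_max_image _ x hne
  have hvu := (Finset.mem_filter.1 hv).2
  have hvM : v ∉ M := fun h => absurd (hu v h) (not_le.2 hvu)
  have h1 : ∑ v, d v < 2 * ∑ w with x v < x w, d w := by
    by_contra! h
    exact hvM (Finset.mem_filter.2 ⟨Finset.mem_univ _, h⟩)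
  have h2 : ∑ w with x v < x w, d w ≤ ∑ w with ¬ x w < x u, d w := by
    refine Finset.sum_le_sum_of_subset_of_nonneg (fun w hw => ?_) fun w _ _ => hd w
    rw [Finset.mem_filter] at hw ⊢
    refine ⟨hw.1, fun h => ?_⟩
    exact absurd (hmax w (Finset.mem_filter.2 ⟨hw.1, h⟩)) (not_le.2 hw.2)
  have h3 := Finset.sum_filter_add_sum_filter_not Finset.univ (fun w => x w < x u) d
  linarith

/-! ### Cheeger's inequality for sweep cuts -/

namespace WeightedGraph

variable {V : Type*}

/-- The total weight of the edges from `S` to `T`. -/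
def edgeWeight (G : WeightedGraph V) (S T : Finset V) : ℝ := ∑ u ∈ S, ∑ v ∈ T, G.weight u v

theorem edgeWeight_comm (G : WeightedGraph V) (S T : Finset V) :
    G.edgeWeight S T = G.edgeWeight T S := by
  unfold edgeWeight
  rw [Finset.sum_comm]
  simp only [G.symm]

theorem edgeWeight_nonneg (G : WeightedGraph V) (S T : Finset V) : 0 ≤ G.edgeWeight S T :=
  Finset.sum_nonneg fun _ _ => Finset.sum_nonneg fun _ _ => G.nonneg _ _

variable [Fintype V]

theorem vertexWeight_nonneg (G : WeightedGraph V) (v : V) : 0 ≤ G.vertexWeight v :=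
  Finset.sum_nonneg fun _ _ => G.nonneg _ _

open Classical in
theorem sum_vertexWeight_eq (G : WeightedGraph V) (S : Finset V) :
    ∑ v ∈ S, G.vertexWeight v = G.edgeWeight S S + G.edgeWeight S Sᶜ := by
  unfold edgeWeight vertexWeight
  rw [← Finset.sum_add_distrib]
  exact Finset.sum_congr rfl fun u _ => (Finset.sum_add_sum_compl S _).symm

/-- The Dirichlet form as a sum over pairs of vertices. -/
theorem sum_weight_mul_sub_sq (G : WeightedGraph V) (x : V → ℝ) :
    ∑ u, ∑ v, G.weight u v * (x u - x v) ^ 2 =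
      2 * (∑ v, G.vertexWeight v * x v ^ 2 - ∑ u, ∑ v, x u * G.weight u v * x v) := by
  have h1 : ∑ u, ∑ v, G.weight u v * x u ^ 2 = ∑ v, G.vertexWeight v * x v ^ 2 := by
    simp only [vertexWeight, Finset.sum_mul]
  have h2 : ∑ u, ∑ v, G.weight u v * x v ^ 2 = ∑ v, G.vertexWeight v * x v ^ 2 := by
    rw [Finset.sum_comm, ← h1]
    simp only [G.symm]
  have h3 : ∑ u, ∑ v, G.weight u v * (x u - x v) ^ 2 =
      ∑ u, ∑ v, G.weight u v * x u ^ 2 + ∑ u, ∑ v, G.weight u v * x v ^ 2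
        - 2 * ∑ u, ∑ v, x u * G.weight u v * x v := by
    simp only [Finset.mul_sum, ← Finset.sum_add_distrib, ← Finset.sum_sub_distrib]
    exact Finset.sum_congr rfl fun u _ => Finset.sum_congr rfl fun v _ => by ring
  rw [h3, h1, h2]
  ring

/-- A set of vertices is a sparse cut if the edges leaving it weigh less than half of those inside
it, and less than half of those inside its complement. -/
def SparseCut [DecidableEq V] (G : WeightedGraph V) (S : Finset V) : Prop :=
  2 * G.edgeWeight S Sᶜ < G.edgeWeight S S ∧ 2 * G.edgeWeight S Sᶜ < G.edgeWeight Sᶜ Sᶜ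

open Classical in
-- The co-area argument. Every nonempty superlevel set S of `y` is a sweep set of `x`, and since it
-- is not sparse, S or its complement has volume at most 3e(S,Sᶜ). The median makes S the smaller
-- side for positive thresholds and Sᶜ for the others. Integration over the threshold gives the
-- claim.
theorem sum_abs_le_of_no_sparse_sweep (G : WeightedGraph V) (x y : V → ℝ) (m : ℝ)
    (hxy : ∀ u v, x u ≤ x v → y u ≤ y v) (hpos : ∀ v, 0 < y v → m < x v)
    (hneg : ∀ v, y v < 0 → x v < m)
    (hm : 2 * ∑ v with m < x v, G.vertexWeight v ≤ ∑ v, G.vertexWeight v)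
    (hm' : 2 * ∑ v with x v < m, G.vertexWeight v ≤ ∑ v, G.vertexWeight v)
    (h : ∀ u, ¬ G.SparseCut (Finset.univ.filter fun v => x u ≤ x v)) :
    ∑ v, G.vertexWeight v * |y v| ≤ 3 * ∑ u, ∑ v, G.weight u v * max (y u - y v) 0 := by
  have key : ∀ t : ℝ, ∑ v, (if min (y v) 0 < t ∧ t ≤ max (y v) 0 then G.vertexWeight v else 0) ≤
      ∑ p : V × V, (if y p.2 < t ∧ t ≤ y p.1 then 3 * G.weight p.1 p.2 else 0) := by
    intro t
    let S := Finset.univ.filter fun v => t ≤ y v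
    have hS : ∑ p : V × V, (if y p.2 < t ∧ t ≤ y p.1 then 3 * G.weight p.1 p.2 else 0) =
        3 * G.edgeWeight S Sᶜ := by
      rw [Fintype.sum_prod_type, edgeWeight, Finset.sum_filter, Finset.mul_sum]
      refine Finset.sum_congr rfl fun u _ => ?_
      split_ifs with hu
      · rw [show Sᶜ = Finset.univ.filter (fun v => y v < t) by ext v; simp [S],
          Finset.sum_filter, Finset.mul_sum]
        refine Finset.sum_congr rfl fun v _ => ?_
        by_cases hv : y v < t <;> simp [hu, hv]
      · simp [hu]
    -- The volume of S is e(S,S) + e(S,Sᶜ), so failing the factor 2 in `SparseCut` gives the factor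
    -- 3.
    have hcut : ∑ v ∈ S, G.vertexWeight v ≤ 3 * G.edgeWeight S Sᶜ ∨
        ∑ v ∈ Sᶜ, G.vertexWeight v ≤ 3 * G.edgeWeight S Sᶜ := by
      rcases S.eq_empty_or_nonempty with he | hne
      · left
        rw [he]
        simp [edgeWeight]
      · obtain ⟨u, hu, hmin⟩ := Finset.exists_min_image S x hne
        have hSu : S = Finset.univ.filter fun v => x u ≤ x v := by
          ext v
          simp only [Finset.mem_filter, Finset.mem_univ, true_and]
          constructor
          · intro hv
            exact hmin v hv
          · intro hv
            simp only [S, Finset.mem_filter, Finset.mem_univ, true_and] at hu ⊢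
            exact hu.trans (hxy u v hv)
        have hu' := h u
        rw [← hSu, SparseCut, not_and_or, not_lt, not_lt] at hu'
        rw [sum_vertexWeight_eq, sum_vertexWeight_eq, compl_compl, G.edgeWeight_comm Sᶜ S]
        rcases hu' with hu' | hu'
        · left; linarith
        · right; linarith
    have hsplit := Finset.sum_add_sum_compl S G.vertexWeight
    rw [hS]
    rcases lt_or_ge 0 t with ht | ht
    · have h1 : ∑ v, (if min (y v) 0 < t ∧ t ≤ max (y v) 0 then G.vertexWeight v else 0) =
          ∑ v ∈ S, G.vertexWeight v := by
        rw [Finset.sum_filter]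
        refine Finset.sum_congr rfl fun v _ => ?_
        have : (min (y v) 0 < t ∧ t ≤ max (y v) 0) ↔ t ≤ y v := by
          rw [min_lt_iff, le_max_iff]
          constructor
          · rintro ⟨-, h | h⟩
            · exact h
            · linarith
          · exact fun h => ⟨Or.inr ht, Or.inl h⟩
        simp only [this]
      have h2 : ∑ v ∈ S, G.vertexWeight v ≤ ∑ v with m < x v, G.vertexWeight v := by
        refine Finset.sum_le_sum_of_subset_of_nonneg (fun v hv => ?_)
          fun v _ _ => G.vertexWeight_nonneg v
        have := (Finset.mem_filter.1 hv).2
        simpa using hpos v (by linarith)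
      rw [h1]
      rcases hcut with hcut | hcut <;> linarith
    · have h1 : ∑ v, (if min (y v) 0 < t ∧ t ≤ max (y v) 0 then G.vertexWeight v else 0) =
          ∑ v ∈ Sᶜ, G.vertexWeight v := by
        rw [show Sᶜ = Finset.univ.filter (fun v => y v < t) by ext v; simp [S],
          Finset.sum_filter]
        refine Finset.sum_congr rfl fun v _ => ?_
        have : (min (y v) 0 < t ∧ t ≤ max (y v) 0) ↔ y v < t := by
          rw [min_lt_iff, le_max_iff]
          constructor
          · rintro ⟨h | h, -⟩
            · exact h
            · linarith
          · exact fun h => ⟨Or.inl h, Or.inr ht⟩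
        simp only [this]
      have h2 : ∑ v ∈ Sᶜ, G.vertexWeight v ≤ ∑ v with x v < m, G.vertexWeight v := by
        refine Finset.sum_le_sum_of_subset_of_nonneg (fun v hv => ?_)
          fun v _ _ => G.vertexWeight_nonneg v
        have : y v < t := by simpa [S] using hv
        simpa using hneg v (by linarith)
      rw [h1]
      rcases hcut with hcut | hcut <;> linarith
  have := sum_mul_length_le (fun v => min (y v) 0) (fun v => max (y v) 0) G.vertexWeight
    (fun p : V × V => y p.2) (fun p => y p.1) (fun p => 3 * G.weight p.1 p.2) key
  rw [Fintype.sum_prod_type] at this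
  calc ∑ v, G.vertexWeight v * |y v|
      = ∑ v, G.vertexWeight v * max (max (y v) 0 - min (y v) 0) 0 := by
        refine Finset.sum_congr rfl fun v _ => ?_
        rw [max_sub_min_eq_abs, zero_sub, abs_neg, max_eq_left (abs_nonneg _)]
    _ ≤ _ := this
    _ = _ := by
        simp only [Finset.mul_sum]
        exact Finset.sum_congr rfl fun u _ => Finset.sum_congr rfl fun v _ => by ring

/-- The left side is at most |a−b|(|a|+|b|), and st ≤ 3s² + t²/12. The constants are chosen so that
the last term can later be absorbed. -/
theorem abs_mul_abs_sub_le (a b : ℝ) :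
    |(a * |a| - b * |b|)| ≤ 3 * (a - b) ^ 2 + (a ^ 2 + b ^ 2) / 6 := by
  rw [abs_le]
  rcases abs_cases a with ⟨ha, ha'⟩ | ⟨ha, ha'⟩ <;> rcases abs_cases b with ⟨hb, hb'⟩ | ⟨hb, hb'⟩ <;>
    rw [ha, hb] <;> constructor <;>
    nlinarith [sq_nonneg (6 * (a - b) - (a + b)), sq_nonneg (6 * (a - b) + (a + b)),
      sq_nonneg (a - b), sq_nonneg (a + b), mul_nonneg (abs_nonneg a) (abs_nonneg b)]

open Classical in
/-- The hard direction of Cheeger's inequality, for the sweep cuts of a single function. -/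
theorem variance_le_of_no_sparse_sweep (G : WeightedGraph V) (x : V → ℝ)
    (h : ∀ u, ¬ G.SparseCut (Finset.univ.filter fun v => x u ≤ x v)) :
    (∑ v, G.vertexWeight v) * ∑ v, G.vertexWeight v * x v ^ 2 - (∑ v, G.vertexWeight v * x v) ^ 2 ≤
      18 * (∑ v, G.vertexWeight v) *
        (∑ v, G.vertexWeight v * x v ^ 2 - ∑ u, ∑ v, x u * G.weight u v * x v) := by
  rcases isEmpty_or_nonempty V with hV | hV
  · simp
  obtain ⟨m, hm, hm'⟩ := exists_weighted_median G.vertexWeight x G.vertexWeight_nonneg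
  have hmono : ∀ a b : ℝ, a ≤ b → a * |a| ≤ b * |b| := by
    intro a b hab
    rcases abs_cases a with ⟨ha, ha'⟩ | ⟨ha, ha'⟩ <;>
      rcases abs_cases b with ⟨hb, hb'⟩ | ⟨hb, hb'⟩ <;> rw [ha, hb] <;> nlinarith
  -- The signed square of x − m is increasing in x, and its absolute value is the square needed for
  -- the variance.
  have key := G.sum_abs_le_of_no_sparse_sweep x (fun v => (x v - m) * |x v - m|) m
    (fun u v huv => hmono _ _ (by linarith))
    (fun v hv => by
      by_contra! hc
      exact absurd hv (not_lt.2 (mul_nonpos_of_nonpos_of_nonneg (by linarith) (abs_nonneg _))))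
    (fun v hv => by
      by_contra! hc
      exact absurd hv (not_lt.2 (mul_nonneg (by linarith) (abs_nonneg _))))
    hm hm' h
  set F := ∑ u, ∑ v, G.weight u v *
    max ((x u - m) * |x u - m| - (x v - m) * |x v - m|) 0 with hF
  have hF' : F = ∑ u, ∑ v, G.weight u v *
      max ((x v - m) * |x v - m| - (x u - m) * |x u - m|) 0 := by
    rw [hF, Finset.sum_comm]
    simp only [G.symm]
  have h2F : 2 * F ≤ 3 * ∑ u, ∑ v, G.weight u v * (x u - x v) ^ 2 +
      (∑ v, G.vertexWeight v * (x v - m) ^ 2) / 3 := by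
    have h1 : ∑ u, ∑ v, G.weight u v * (x u - m) ^ 2 =
        ∑ v, G.vertexWeight v * (x v - m) ^ 2 := by
      simp only [vertexWeight, Finset.sum_mul]
    have h2 : ∑ u, ∑ v, G.weight u v * (x v - m) ^ 2 =
        ∑ v, G.vertexWeight v * (x v - m) ^ 2 := by
      rw [Finset.sum_comm, ← h1]
      simp only [G.symm]
    have h3 : 2 * F ≤ ∑ u, ∑ v, (3 * (G.weight u v * (x u - x v) ^ 2) +
        (G.weight u v * (x u - m) ^ 2 + G.weight u v * (x v - m) ^ 2) / 6) := by
      rw [two_mul]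
      nth_rewrite 2 [hF']
      rw [hF]
      simp only [← Finset.sum_add_distrib]
      refine Finset.sum_le_sum fun u _ => Finset.sum_le_sum fun v _ => ?_
      rw [← mul_add]
      have hmax : ∀ a b : ℝ, max (a - b) 0 + max (b - a) 0 = |a - b| := by
        intro a b
        rcases le_total a b with hab | hab
        · rw [max_eq_right (by linarith), max_eq_left (by linarith), abs_of_nonpos (by linarith)]
          ring
        · rw [max_eq_left (by linarith), max_eq_right (by linarith), abs_of_nonneg (by linarith)]
          ring
      rw [hmax]
      have := mul_le_mul_of_nonneg_left (abs_mul_abs_sub_le (x u - m) (x v - m)) (G.nonneg u v)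
      rw [show x u - m - (x v - m) = x u - x v by ring] at this
      linarith
    simp only [Finset.sum_add_distrib, ← Finset.mul_sum, ← Finset.sum_div, h1, h2] at h3
    linarith
  have hz : ∑ v, G.vertexWeight v * |((x v - m) * |x v - m|)| =
      ∑ v, G.vertexWeight v * (x v - m) ^ 2 := by
    refine Finset.sum_congr rfl fun v _ => ?_
    rw [abs_mul, abs_abs, ← sq, sq_abs]
  rw [hz] at key
  rw [sum_weight_mul_sub_sq] at h2F
  have hexp : ∑ v, G.vertexWeight v * (x v - m) ^ 2 = ∑ v, G.vertexWeight v * x v ^ 2 -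
      2 * m * ∑ v, G.vertexWeight v * x v + m ^ 2 * ∑ v, G.vertexWeight v := by
    simp only [Finset.mul_sum, ← Finset.sum_add_distrib, ← Finset.sum_sub_distrib]
    exact Finset.sum_congr rfl fun v _ => by ring
  -- With Q the left side and E the Dirichlet form, Q ≤ 3F and 2F ≤ 6E + Q/3 give Q ≤ 9E + Q/2.
  have hfin : ∑ v, G.vertexWeight v * (x v - m) ^ 2 ≤
      18 * (∑ v, G.vertexWeight v * x v ^ 2 - ∑ u, ∑ v, x u * G.weight u v * x v) := by
    linarith
  have hvol : 0 ≤ ∑ v, G.vertexWeight v := Finset.sum_nonneg fun v _ => G.vertexWeight_nonneg v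
  have := mul_le_mul_of_nonneg_left hfin hvol
  rw [hexp] at this
  -- The second moment about m dominates the one about the mean; the difference is this square.
  nlinarith [sq_nonneg (∑ v, G.vertexWeight v * x v - m * ∑ v, G.vertexWeight v)]

end WeightedGraph

/-! ### From sweep cuts to eigenvalues -/

namespace WeightedGraph

variable {V : Type*} [Fintype V]

/-- The transition matrix of the random walk. -/
noncomputable def walkMatrix (G : WeightedGraph V) : Matrix V V ℝ :=
  Matrix.of fun u v => G.weight u v / G.vertexWeight u

theorem weight_eq_zero_of_vertexWeight_eq_zero (G : WeightedGraph V) {u : V}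
    (h : G.vertexWeight u = 0) (v : V) : G.weight u v = 0 :=
  (Finset.sum_eq_zero_iff_of_nonneg fun v _ => G.nonneg u v).1 h v (Finset.mem_univ v)

theorem vertexWeight_mul_walkMatrix (G : WeightedGraph V) (u v : V) :
    G.vertexWeight u * G.walkMatrix u v = G.weight u v := by
  by_cases h : G.vertexWeight u = 0
  · rw [h, G.weight_eq_zero_of_vertexWeight_eq_zero h, zero_mul]
  · simp only [walkMatrix, Matrix.of_apply]
    field_simp

variable [DecidableEq V]

theorem diagonal_mul_walkMatrix (G : WeightedGraph V) :
    Matrix.diagonal G.vertexWeight * G.walkMatrix = Matrix.of G.weight := by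
  ext u v
  rw [Matrix.diagonal_mul, vertexWeight_mul_walkMatrix, Matrix.of_apply]

/-- Reversibility: DP is the symmetric weight matrix, so DP = PᵀD. -/
theorem semiconjBy_walkMatrix_transpose (G : WeightedGraph V) :
    SemiconjBy (Matrix.diagonal G.vertexWeight) G.walkMatrix G.walkMatrix.transpose := by
  unfold SemiconjBy
  ext u v
  rw [Matrix.diagonal_mul, Matrix.mul_diagonal, Matrix.transpose_apply, mul_comm _ (_ : ℝ),
    mul_comm (G.walkMatrix v u), vertexWeight_mul_walkMatrix, mul_comm,
    vertexWeight_mul_walkMatrix, G.symm]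

theorem sum_vertexWeight_mul_walkMatrix_pow (G : WeightedGraph V) (k : ℕ) (i : V) :
    ∑ v, G.vertexWeight v * (G.walkMatrix ^ k) v i = G.vertexWeight i := by
  have h : Matrix.vecMul G.vertexWeight (G.walkMatrix ^ k) = G.vertexWeight := by
    induction k with
    | zero => simp
    | succ k ih =>
      rw [pow_succ, ← Matrix.vecMul_vecMul, ih]
      funext v
      simp only [Matrix.vecMul, dotProduct, vertexWeight_mul_walkMatrix]
      exact Finset.sum_congr rfl fun u _ => G.symm u v
  exact congrFun h i

theorem transpose_pow_mul_diagonal_mul_pow (G : WeightedGraph V) (k l : ℕ) :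
    (G.walkMatrix ^ k).transpose * (Matrix.diagonal G.vertexWeight * G.walkMatrix ^ l) =
      Matrix.diagonal G.vertexWeight * G.walkMatrix ^ (k + l) := by
  rw [← mul_assoc, Matrix.transpose_pow, ← (G.semiconjBy_walkMatrix_transpose.pow_right k).eq,
    mul_assoc, pow_add]

/-- By reversibility (Pᵏ)ᵀDPᵏ = DP²ᵏ; the second moment of a column is a diagonal entry of this
matrix. This is what turns variances of columns into traces. -/
theorem sum_vertexWeight_mul_walkMatrix_pow_sq (G : WeightedGraph V) (k : ℕ) (i : V) :
    ∑ v, G.vertexWeight v * (G.walkMatrix ^ k) v i ^ 2 =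
      G.vertexWeight i * (G.walkMatrix ^ (2 * k)) i i := by
  have h := congrFun (congrFun (G.transpose_pow_mul_diagonal_mul_pow k k) i) i
  rw [Matrix.diagonal_mul, Matrix.mul_apply] at h
  rw [two_mul, ← h]
  refine Finset.sum_congr rfl fun v _ => ?_
  rw [Matrix.diagonal_mul, Matrix.transpose_apply]
  ring

theorem sum_walkMatrix_pow_mul_weight (G : WeightedGraph V) (k : ℕ) (i : V) :
    ∑ u, ∑ v, (G.walkMatrix ^ k) u i * G.weight u v * (G.walkMatrix ^ k) v i =
      G.vertexWeight i * (G.walkMatrix ^ (2 * k + 1)) i i := by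
  have h := congrFun (congrFun (G.transpose_pow_mul_diagonal_mul_pow k (k + 1)) i) i
  rw [pow_succ' _ k, ← mul_assoc (Matrix.diagonal _), diagonal_mul_walkMatrix,
    Matrix.diagonal_mul, Matrix.mul_apply] at h
  rw [show 2 * k + 1 = k + (k + 1) by ring, ← h]
  refine Finset.sum_congr rfl fun u _ => ?_
  rw [Matrix.mul_apply, Finset.mul_sum]
  refine Finset.sum_congr rfl fun v _ => ?_
  rw [Matrix.transpose_apply, Matrix.of_apply]
  ring

theorem walkMatrix_pow_apply_eq_zero (G : WeightedGraph V) {i : V} (hi : G.vertexWeight i = 0)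
    (k : ℕ) (j : V) : (G.walkMatrix ^ (k + 1)) i j = 0 := by
  rw [pow_succ', Matrix.mul_apply]
  refine Finset.sum_eq_zero fun v _ => ?_
  simp [walkMatrix, hi]

/-- D^(1/2)P = ND^(1/2) holds even with vertices of weight zero, where D^(1/2) is not invertible:
their rows and columns of weights vanish. -/
theorem semiconjBy_normAdj (G : WeightedGraph V) :
    SemiconjBy (Matrix.diagonal fun v => √(G.vertexWeight v)) G.walkMatrix G.normAdj := by
  unfold SemiconjBy
  ext u v
  rw [Matrix.diagonal_mul, Matrix.mul_diagonal]
  simp only [walkMatrix, normAdj, Matrix.of_apply]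
  rw [Real.sqrt_mul (G.vertexWeight_nonneg u)]
  by_cases hu : G.vertexWeight u = 0
  · simp [hu]
  by_cases hv : G.vertexWeight v = 0
  · rw [G.symm, G.weight_eq_zero_of_vertexWeight_eq_zero hv]
    simp
  have hu' : 0 < √(G.vertexWeight u) :=
    Real.sqrt_pos.2 ((G.vertexWeight_nonneg u).lt_of_ne' hu)
  have hv' : 0 < √(G.vertexWeight v) :=
    Real.sqrt_pos.2 ((G.vertexWeight_nonneg v).lt_of_ne' hv)
  have h := Real.sq_sqrt (G.vertexWeight_nonneg u)
  field_simp
  linear_combination (G.weight u v) * h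

theorem trace_normAdj_pow (G : WeightedGraph V) (k : ℕ) :
    (G.normAdj ^ (k + 1)).trace = (G.walkMatrix ^ (k + 1)).trace := by
  refine Finset.sum_congr rfl fun i _ => ?_
  rw [Matrix.diag_apply, Matrix.diag_apply]
  by_cases hi : G.vertexWeight i = 0
  · rw [walkMatrix_pow_apply_eq_zero G hi, pow_succ', Matrix.mul_apply]
    refine Finset.sum_eq_zero fun v _ => ?_
    simp [normAdj, hi]
  · have h := congrFun (congrFun (G.semiconjBy_normAdj.pow_right (k + 1)).eq i) i
    rw [Matrix.diagonal_mul, Matrix.mul_diagonal, mul_comm] at h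
    refine (mul_right_cancel₀ ?_ h).symm
    exact (Real.sqrt_pos.2 ((G.vertexWeight_nonneg i).lt_of_ne' hi)).ne'

end WeightedGraph

/-! ### From traces of powers to the second eigenvalue -/

theorem trace_pow_eq_sum_eigenvalues_pow {V : Type*} [Fintype V] [DecidableEq V]
    {A : Matrix V V ℝ} (hA : A.IsHermitian) (k : ℕ) :
    (A ^ k).trace = ∑ i, hA.eigenvalues i ^ k := by
  conv_lhs => rw [hA.spectral_theorem, ← map_pow, Unitary.conjStarAlgAut_apply,
    Matrix.trace_mul_cycle]
  simp [Matrix.diagonal_pow, Matrix.trace_diagonal]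

namespace WeightedGraph

variable {V : Type*} [Fintype V]

open Classical in
theorem lam_le_of_forall_ne (G : WeightedGraph V) (c : ℝ) (hc : 0 ≤ c) (j : V)
    (h : ∀ i, i ≠ j → |G.normAdj_isHermitian.eigenvalues i| ≤ c) : G.lam ≤ c := by
  unfold lam
  set s : Multiset ℝ := Finset.univ.val.map fun i => |G.normAdj_isHermitian.eigenvalues i| with hs
  by_contra! hcon
  have hsort : (s.sort (· ≥ ·)).Pairwise (· ≥ ·) := Multiset.pairwise_sort s _
  have hcoe : ((s.sort (· ≥ ·) : List ℝ) : Multiset ℝ) = s := Multiset.sort_eq s _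
  have hcount : s.countP (c < ·) ≤ 1 := by
    rw [hs, Multiset.countP_map]
    refine (Multiset.card_le_card (Multiset.monotone_filter_right (q := fun i => i = j) _ ?_)).trans
      (Finset.card_le_one (s := Finset.univ.filter fun i => i = j) |>.2 (by simp))
    intro i hi
    by_contra hij
    exact absurd (h i hij) (not_le.2 hi)
  rw [← hcoe, Multiset.coe_countP] at hcount
  match hl : s.sort (· ≥ ·) with
  | [] => rw [hl] at hcon; simp at hcon; linarith
  | [a] => rw [hl] at hcon; simp at hcon; linarith
  | a :: b :: l =>
    rw [hl] at hcon hcount hsort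
    have hb : c < b := by simpa using hcon
    have ha : c < a := hb.trans_le ((List.pairwise_cons.1 hsort).1 b (by simp))
    rw [List.countP_cons_of_pos (by simpa using ha), List.countP_cons_of_pos (by simpa using hb)]
      at hcount
    omega

open Classical in
theorem eigenvalues_nonneg_of_form_nonneg (G : WeightedGraph V)
    (h : ∀ z : V → ℝ, 0 ≤ ∑ u, ∑ v, z u * G.weight u v * z v) (i : V) :
    0 ≤ G.normAdj_isHermitian.eigenvalues i := by
  have hN : G.normAdj.PosSemidef := by
    refine Matrix.PosSemidef.of_dotProduct_mulVec_nonneg G.normAdj_isHermitian fun x => ?_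
    have := h fun v => x v / √(G.vertexWeight v)
    refine this.trans_eq ?_
    simp only [dotProduct, Matrix.mulVec, Finset.mul_sum, normAdj, Matrix.of_apply]
    refine Finset.sum_congr rfl fun u _ => Finset.sum_congr rfl fun v _ => ?_
    rw [Real.sqrt_mul (G.vertexWeight_nonneg u)]
    simp only [Pi.star_apply, star_trivial]
    ring
  exact hN.eigenvalues_nonneg i

open Classical in
theorem exists_eigenvalues_eq_one (G : WeightedGraph V) (hvol : 0 < ∑ v, G.vertexWeight v) :
    ∃ j, G.normAdj_isHermitian.eigenvalues j = 1 := by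
  have hs : G.normAdj.mulVec (fun v => √(G.vertexWeight v)) = fun v => √(G.vertexWeight v) := by
    funext u
    have h1 : ∀ v, G.normAdj u v * √(G.vertexWeight v) =
        √(G.vertexWeight u) * G.walkMatrix u v := by
      intro v
      have := congrFun (congrFun G.semiconjBy_normAdj.eq u) v
      rw [Matrix.diagonal_mul, Matrix.mul_diagonal] at this
      exact this.symm
    simp only [Matrix.mulVec, dotProduct, h1]
    rw [← Finset.mul_sum]
    by_cases hu : G.vertexWeight u = 0
    · simp [hu]
    · have : ∑ v, G.walkMatrix u v = 1 := by
        simp only [walkMatrix, Matrix.of_apply]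
        rw [← Finset.sum_div]
        exact div_self hu
      rw [this, mul_one]
  have hne : (fun v => √(G.vertexWeight v)) ≠ (0 : V → ℝ) := by
    intro h0
    refine hvol.ne' (Finset.sum_eq_zero fun v _ => ?_)
    have := congrFun h0 v
    simpa [Real.sqrt_eq_zero (G.vertexWeight_nonneg v)] using this
  have hev : Module.End.HasEigenvalue (Matrix.toLin' G.normAdj) 1 :=
    Module.End.hasEigenvalue_of_hasEigenvector
      (x := fun v => √(G.vertexWeight v))
      ⟨Module.End.mem_eigenspace_iff.2 (by rw [Matrix.toLin'_apply, hs, one_smul]), hne⟩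
  have hsp : (1 : ℝ) ∈ spectrum ℝ G.normAdj := by
    rw [← Matrix.spectrum_toLin']
    exact hev.mem_spectrum
  rw [G.normAdj_isHermitian.spectrum_real_eq_range_eigenvalues] at hsp
  exact hsp

open Classical in
-- Column i of Pᵏ has weighted sum d_i by stationarity, second moment d_i(P²ᵏ)_ii and quadratic form
-- d_i(P²ᵏ⁺¹)_ii. Cheeger's bound for it, divided by d_i and the volume, is summed over i.
theorem trace_sub_one_le_of_no_sparse_sweep (G : WeightedGraph V)
    (hvol : 0 < ∑ v, G.vertexWeight v) (k : ℕ) (hk : 0 < k)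
    (h : ∀ i u, ¬ G.SparseCut
      (Finset.univ.filter fun v => (G.walkMatrix ^ k) u i ≤ (G.walkMatrix ^ k) v i)) :
    (G.walkMatrix ^ (2 * k)).trace - 1 ≤
      18 * ((G.walkMatrix ^ (2 * k)).trace - (G.walkMatrix ^ (2 * k + 1)).trace) := by
  have key : ∀ i, (G.walkMatrix ^ (2 * k)) i i - G.vertexWeight i / ∑ v, G.vertexWeight v ≤
      18 * ((G.walkMatrix ^ (2 * k)) i i - (G.walkMatrix ^ (2 * k + 1)) i i) := by
    intro i
    by_cases hi : G.vertexWeight i = 0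
    · obtain ⟨l, rfl⟩ : ∃ l, k = l + 1 := ⟨k - 1, by omega⟩
      rw [walkMatrix_pow_apply_eq_zero G hi, show 2 * (l + 1) = (2 * l + 1) + 1 by ring,
        walkMatrix_pow_apply_eq_zero G hi, hi]
      simp
    · have hd : 0 < G.vertexWeight i := (G.vertexWeight_nonneg i).lt_of_ne' hi
      have := G.variance_le_of_no_sparse_sweep (fun v => (G.walkMatrix ^ k) v i) (h i)
      rw [sum_vertexWeight_mul_walkMatrix_pow_sq, sum_vertexWeight_mul_walkMatrix_pow,
        sum_walkMatrix_pow_mul_weight] at this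
      rw [sub_le_iff_le_add, ← sub_le_iff_le_add', le_div_iff₀ hvol]
      refine le_of_mul_le_mul_left ?_ hd
      linarith
  have := Finset.sum_le_sum fun i (_ : i ∈ Finset.univ) => key i
  rw [Finset.sum_sub_distrib, ← Finset.mul_sum, Finset.sum_sub_distrib, ← Finset.sum_div,
    div_self hvol.ne'] at this
  exact this

/-- The ratio of 0.99 to 17/18 is 1782/1700, whose 200th power exceeds 33. Bernoulli's inequality
makes its 200n-th power at least 32n, and 0.82 · 32 > 17. This is why the walk takes 100n steps. -/
theorem pow_bound {n : ℕ} (hn : 0 < n) :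
    17 * n * (17 / 18 : ℝ) ^ (2 * (100 * n)) < 0.82 * 0.99 ^ (2 * (100 * n)) := by
  have h1 : (0.99 : ℝ) ^ (2 * (100 * n)) =
      (1782 / 1700) ^ (2 * (100 * n)) * (17 / 18) ^ (2 * (100 * n)) := by
    rw [← mul_pow]
    norm_num
  have h2 : (32 * n : ℝ) ≤ (1782 / 1700) ^ (2 * (100 * n)) := by
    have h3 : (33 : ℝ) ≤ (1782 / 1700) ^ 200 := by
      have h4 : (2 : ℝ) ≤ (1782 / 1700) ^ 20 := by norm_num
      calc (33 : ℝ) ≤ 2 ^ 10 := by norm_num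
        _ ≤ ((1782 / 1700) ^ 20) ^ 10 := by gcongr
        _ = (1782 / 1700) ^ 200 := by rw [← pow_mul]
    have h5 := one_add_mul_le_pow (a := (32 : ℝ)) (by norm_num) n
    calc (32 * n : ℝ) ≤ 1 + n * 32 := by linarith
      _ ≤ (1 + 32) ^ n := h5
      _ = 33 ^ n := by norm_num
      _ ≤ ((1782 / 1700) ^ 200) ^ n := by gcongr
      _ = (1782 / 1700) ^ (2 * (100 * n)) := by rw [← pow_mul]; congr 1; ring
  rw [h1, ← mul_assoc (0.82 : ℝ)]
  refine mul_lt_mul_of_pos_right ?_ (by positivity)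
  have : (1 : ℝ) ≤ n := by exact_mod_cast hn
  linarith

open Classical in
/-- If no sweep cut of a column of a high power of the random walk is sparse and the quadratic form of
the weights is nonnegative, then the second eigenvalue is bounded away from one. -/
theorem lam_le_of_no_sparse_sweep (G : WeightedGraph V)
    (hpsd : ∀ z : V → ℝ, 0 ≤ ∑ u, ∑ v, z u * G.weight u v * z v)
    (hvol : 0 < ∑ v, G.vertexWeight v) (n : ℕ) (hn : 0 < n) (hcard : Fintype.card V ≤ n)
    (h : ∀ i u, ¬ G.SparseCut (Finset.univ.filter fun v =>
      (G.walkMatrix ^ (100 * n)) u i ≤ (G.walkMatrix ^ (100 * n)) v i)) :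
    G.lam ≤ 99 / 100 := by
  obtain ⟨j, hj⟩ := G.exists_eigenvalues_eq_one hvol
  refine G.lam_le_of_forall_ne _ (by norm_num) j fun i hij => ?_
  have hpos := G.eigenvalues_nonneg_of_form_nonneg hpsd
  rw [abs_of_nonneg (hpos i)]
  by_contra! hcon
  have htr := G.trace_sub_one_le_of_no_sparse_sweep hvol (100 * n) (by omega) h
  obtain ⟨l, hl⟩ : ∃ l, 2 * (100 * n) = l + 1 := ⟨2 * (100 * n) - 1, by omega⟩
  have e1 := G.trace_normAdj_pow l
  have e2 := G.trace_normAdj_pow (l + 1)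
  rw [← hl] at e1 e2
  rw [← e1, ← e2, trace_pow_eq_sum_eigenvalues_pow G.normAdj_isHermitian,
    trace_pow_eq_sum_eigenvalues_pow G.normAdj_isHermitian] at htr
  have hb := pow_bound hn
  set K := 2 * (100 * n) with hK
  set ev := G.normAdj_isHermitian.eigenvalues with hev
  have hsum : ∑ v, ev v ^ K * (18 * ev v - 17) ≤ 1 := by
    have : ∑ v, ev v ^ K * (18 * ev v - 17) = 18 * ∑ v, ev v ^ (K + 1) - 17 * ∑ v, ev v ^ K := by
      rw [Finset.mul_sum, Finset.mul_sum, ← Finset.sum_sub_distrib]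
      exact Finset.sum_congr rfl fun v _ => by ring
    linarith
  -- Only eigenvalues below 17/18 contribute negatively, and their high powers are tiny.
  have hlow : ∀ v, -(17 * (17 / 18 : ℝ) ^ K) ≤ ev v ^ K * (18 * ev v - 17) := by
    intro v
    have h0 : 0 ≤ ev v ^ K := pow_nonneg (hpos v) K
    rcases le_total (17 / 18) (ev v) with hv | hv
    · have : 0 ≤ ev v ^ K * (18 * ev v - 17) := mul_nonneg h0 (by linarith)
      have : (0 : ℝ) ≤ 17 * (17 / 18 : ℝ) ^ K := by positivity
      linarith
    · have h1 : ev v ^ K ≤ (17 / 18 : ℝ) ^ K := pow_le_pow_left₀ (hpos v) hv K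
      have := mul_nonneg h0 (hpos v)
      linarith
  -- Here 0.82 = 18 · 0.99 − 17.
  have hi : 0.82 * (0.99 : ℝ) ^ K ≤ ev i ^ K * (18 * ev i - 17) := by
    have h1 : (0.99 : ℝ) ^ K ≤ ev i ^ K := pow_le_pow_left₀ (by norm_num) (by linarith) K
    have h2 : (0.82 : ℝ) ≤ 18 * ev i - 17 := by linarith
    have h3 : (0 : ℝ) ≤ 0.99 ^ K := by positivity
    nlinarith
  rw [← Finset.add_sum_erase _ _ (Finset.mem_univ j),
    ← Finset.add_sum_erase _ _ (Finset.mem_erase.2 ⟨hij, Finset.mem_univ i⟩), hj] at hsum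
  have hrest := Finset.sum_le_sum
    fun v (_ : v ∈ (Finset.univ.erase j).erase i) => hlow v
  rw [Finset.sum_const, nsmul_eq_mul] at hrest
  have hcard' : (((Finset.univ.erase j).erase i).card : ℝ) ≤ n := by
    exact_mod_cast (Finset.card_le_univ _).trans hcard
  have hK0 : (0 : ℝ) ≤ 17 * (17 / 18 : ℝ) ^ K := by positivity
  have := mul_le_mul_of_nonneg_right hcard' hK0
  rw [one_pow] at hsum
  linarith

end WeightedGraph

/-! ### Mixing in the two-step walk -/

namespace BipartiteDist

variable {V₂ V₁ : Type*} [Fintype V₂] [Fintype V₁] (X : BipartiteDist V₂ V₁)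

theorem joint_eq_zero_of_marg₁_eq_zero {s : V₁} (h : X.marg₁ s = 0) (t : V₂) : X.joint t s = 0 :=
  (Finset.sum_eq_zero_iff_of_nonneg fun t _ => X.joint_nonneg t s).1 h t (Finset.mem_univ t)

theorem marg₁_mul_cond₂ (s : V₁) (t : V₂) : X.marg₁ s * X.cond₂ s t = X.joint t s := by
  unfold cond₂
  by_cases h : X.marg₁ s = 0
  · rw [h, X.joint_eq_zero_of_marg₁_eq_zero h, zero_mul]
  · field_simp

theorem sum_cond₂ {s : V₁} (h : X.marg₁ s ≠ 0) : ∑ t, X.cond₂ s t = 1 := by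
  unfold cond₂
  rw [← Finset.sum_div]
  exact div_self h

theorem sum_cond₂_mem_Icc (s : V₁) (B : Finset V₂) :
    ∑ t ∈ B, X.cond₂ s t ∈ Set.Icc (0 : ℝ) 1 := by
  refine ⟨Finset.sum_nonneg fun t _ => X.cond₂_nonneg s t, ?_⟩
  refine (Finset.sum_le_sum_of_subset_of_nonneg (Finset.subset_univ B)
    fun t _ _ => X.cond₂_nonneg s t).trans ?_
  by_cases h : X.marg₁ s = 0
  · simp [cond₂, h]
  · exact (X.sum_cond₂ h).le

theorem nbr_nonneg (t : V₂) (s : V₁) : 0 ≤ X.nbr t s := by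
  unfold nbr
  split_ifs <;> positivity

theorem sum_nbr_le_one (t : V₂) : ∑ s, X.nbr t s ≤ 1 := by
  classical
  unfold nbr
  rw [← Finset.sum_filter, Finset.sum_const, nsmul_eq_mul, mul_one_div]
  convert div_self_le_one ((Finset.univ.filter (X.Adj t)).card : ℝ)

theorem sum_joint (t : V₂) : ∑ s, X.joint t s = X.W t := by
  classical
  unfold joint
  rw [← Finset.mul_sum]
  by_cases h : X.W t = 0
  · rw [h, zero_mul]
  · have : ∑ s, X.nbr t s = 1 := by
      obtain ⟨s, hs⟩ := X.exists_adj t h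
      unfold nbr
      rw [← Finset.sum_filter, Finset.sum_const, nsmul_eq_mul, mul_one_div]
      convert div_self (a := ((Finset.univ.filter (X.Adj t)).card : ℝ)) ?_
      exact Nat.cast_ne_zero.2 (Finset.card_ne_zero_of_mem
        (Finset.mem_filter.2 ⟨Finset.mem_univ s, hs⟩))
    rw [this, mul_one]

theorem twoStep_weight (u v : V₂) :
    X.twoStep.weight u v = ∑ s, X.joint u s * X.cond₂ s v := by
  refine Finset.sum_congr rfl fun s _ => ?_
  rw [← mul_assoc, marg₁_mul_cond₂]

theorem twoStep_vertexWeight (v : V₂) : X.twoStep.vertexWeight v = X.W v := by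
  unfold WeightedGraph.vertexWeight
  simp only [twoStep_weight]
  rw [Finset.sum_comm, ← sum_joint]
  refine Finset.sum_congr rfl fun s _ => ?_
  rw [← Finset.mul_sum]
  by_cases h : X.marg₁ s = 0
  · rw [X.joint_eq_zero_of_marg₁_eq_zero h, zero_mul]
  · rw [X.sum_cond₂ h, mul_one]

theorem twoStep_measure (A : Finset V₂) : X.twoStep.measure A = ∑ v ∈ A, X.W v := by
  unfold WeightedGraph.measure
  simp only [twoStep_vertexWeight]
  rw [X.W_mem.2, div_one]

/-- Given s, the two endpoints are independent with the same law, so the form is an average of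
squares. -/
theorem twoStep_form_nonneg (z : V₂ → ℝ) :
    0 ≤ ∑ u, ∑ v, z u * X.twoStep.weight u v * z v := by
  have h : ∑ u, ∑ v, z u * X.twoStep.weight u v * z v =
      ∑ s, X.marg₁ s * (∑ u, z u * X.cond₂ s u) ^ 2 := by
    simp only [twoStep, sq, Finset.mul_sum, Finset.sum_mul]
    conv_rhs => rw [Finset.sum_comm]
    refine Finset.sum_congr rfl fun u _ => ?_
    rw [Finset.sum_comm]
    exact Finset.sum_congr rfl fun s _ => Finset.sum_congr rfl fun v _ => by ring
  rw [h]
  exact Finset.sum_nonneg fun s _ => mul_nonneg (X.marg₁_nonneg s) (sq_nonneg _)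

theorem twoStep_edgeWeight (R B : Finset V₂) :
    X.twoStep.edgeWeight R B =
      ∑ t ∈ R, X.W t * ∑ s, X.nbr t s * ∑ u ∈ B, X.cond₂ s u := by
  unfold WeightedGraph.edgeWeight
  refine Finset.sum_congr rfl fun t _ => ?_
  simp only [twoStep_weight]
  rw [Finset.sum_comm, Finset.mul_sum]
  refine Finset.sum_congr rfl fun s _ => ?_
  rw [← Finset.mul_sum, joint, mul_assoc]

theorem sum_marg₁_mul_sum_cond₂ (B : Finset V₂) :
    ∑ s, X.marg₁ s * ∑ u ∈ B, X.cond₂ s u = ∑ u ∈ B, X.W u := by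
  simp only [Finset.mul_sum, marg₁_mul_cond₂]
  rw [Finset.sum_comm]
  simp only [sum_joint]

variable {X} {α δ : ℝ}

/-- The test function is the conditional probability of B given s, whose mean is W(B); averaged over
R it gives e(R,B). The exceptional t have total weight at most δ: they are dropped in the lower
bound and counted with value 1 in the upper one. -/
theorem IsSampler.edgeWeight_bounds (hX : X.IsSampler α δ) (hα₀ : 0 ≤ α) (R B : Finset V₂) :
    (α ≤ ∑ v ∈ B, X.W v → (∑ v ∈ R, X.W v - δ) * (∑ v ∈ B, X.W v - α) ≤
      X.twoStep.edgeWeight R B) ∧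
    X.twoStep.edgeWeight R B ≤ (∑ v ∈ R, X.W v) * (∑ v ∈ B, X.W v + α) + δ := by
  classical
  have hW := X.W_mem.1
  have hbad := hX (fun s => ∑ u ∈ B, X.cond₂ s u) fun s => X.sum_cond₂_mem_Icc s B
  rw [sum_marg₁_mul_sum_cond₂] at hbad
  rw [twoStep_edgeWeight]
  set m := ∑ v ∈ B, X.W v
  set h : V₂ → ℝ := fun t => ∑ s, X.nbr t s * ∑ u ∈ B, X.cond₂ s u with hh
  have h0 : ∀ t, 0 ≤ h t := fun t => Finset.sum_nonneg fun s _ =>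
    mul_nonneg (X.nbr_nonneg t s) (X.sum_cond₂_mem_Icc s B).1
  have h1 : ∀ t, h t ≤ 1 := fun t => (Finset.sum_le_sum fun s _ =>
    mul_le_of_le_one_right (X.nbr_nonneg t s) (X.sum_cond₂_mem_Icc s B).2).trans (X.sum_nbr_le_one t)
  have hbadR : ∑ t ∈ R, (if α ≤ |h t - m| then X.W t else 0) ≤ δ := by
    refine (Finset.sum_le_sum_of_subset_of_nonneg (Finset.subset_univ R) fun t _ _ => ?_).trans ?_
    · split_ifs
      · exact hW t
      · exact le_rfl
    · rw [← Finset.sum_filter]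
      convert hbad
  constructor
  · intro hα
    have key : ∑ t ∈ R, (X.W t * (m - α) - (if α ≤ |h t - m| then X.W t else 0) * (m - α)) ≤
        ∑ t ∈ R, X.W t * h t := by
      refine Finset.sum_le_sum fun t _ => ?_
      split_ifs with hc
      · have := mul_nonneg (hW t) (h0 t)
        linarith
      · have := (abs_lt.1 (not_le.1 hc)).1
        have := mul_le_mul_of_nonneg_left (by linarith : m - α ≤ h t) (hW t)
        linarith
    rw [Finset.sum_sub_distrib, ← Finset.sum_mul, ← Finset.sum_mul] at key
    have := mul_le_mul_of_nonneg_right hbadR (sub_nonneg.2 hα)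
    linarith
  · have key : ∑ t ∈ R, X.W t * h t ≤
        ∑ t ∈ R, (X.W t * (m + α) + (if α ≤ |h t - m| then X.W t else 0) -
          if α ≤ |h t - m| then X.W t * (m + α) else 0) := by
      refine Finset.sum_le_sum fun t _ => ?_
      split_ifs with hc
      · have := mul_le_mul_of_nonneg_left (h1 t) (hW t)
        linarith
      · have := (abs_lt.1 (not_le.1 hc)).2
        have := mul_le_mul_of_nonneg_left (by linarith : h t ≤ m + α) (hW t)
        linarith
    rw [Finset.sum_sub_distrib, Finset.sum_add_distrib, ← Finset.sum_mul] at key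
    have h2 : 0 ≤ ∑ t ∈ R, if α ≤ |h t - m| then X.W t * (m + α) else 0 := by
      refine Finset.sum_nonneg fun t _ => ?_
      split_ifs with hc
      · have hm : 0 ≤ m := Finset.sum_nonneg fun v _ => hW v
        exact mul_nonneg (hW t) (by linarith)
      · exact le_rfl
    linarith

end BipartiteDist

/-! ### Induced graphs and pruned sets -/

namespace WeightedGraph

variable {V : Type*} (G : WeightedGraph V)

theorem edgeWeight_mono {S S' T T' : Finset V} (hS : S ⊆ S') (hT : T ⊆ T') :
    G.edgeWeight S T ≤ G.edgeWeight S' T' :=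
  (Finset.sum_le_sum_of_subset_of_nonneg hS fun _ _ _ => Finset.sum_nonneg fun _ _ =>
    G.nonneg _ _).trans (Finset.sum_le_sum fun _ _ =>
      Finset.sum_le_sum_of_subset_of_nonneg hT fun _ _ _ => G.nonneg _ _)

theorem edgeWeight_induce (B : Finset V) (S T : Finset B) :
    (G.induce B).edgeWeight S T =
      G.edgeWeight (S.map (Function.Embedding.subtype _)) (T.map (Function.Embedding.subtype _)) := by
  simp [edgeWeight, induce]

theorem sum_vertexWeight_induce (B : Finset V) :
    ∑ v, (G.induce B).vertexWeight v = G.edgeWeight B B := by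
  simp only [vertexWeight, induce, edgeWeight]
  rw [← Finset.sum_coe_sort B]
  exact Finset.sum_congr rfl fun u _ => Finset.sum_coe_sort B (G.weight u)

variable [DecidableEq V]

theorem edgeWeight_union_left {S S' : Finset V} (h : Disjoint S S') (T : Finset V) :
    G.edgeWeight (S ∪ S') T = G.edgeWeight S T + G.edgeWeight S' T :=
  Finset.sum_union h

/-- The part `S` of `B` is a sparse cut of the graph induced on `B`. -/
def SparseIn (B S : Finset V) : Prop :=
  2 * G.edgeWeight S (B \ S) < G.edgeWeight S S ∧
    2 * G.edgeWeight S (B \ S) < G.edgeWeight (B \ S) (B \ S)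

theorem sparseCut_induce (B : Finset V) (S : Finset B) :
    (G.induce B).SparseCut S ↔ G.SparseIn B (S.map (Function.Embedding.subtype _)) := by
  have h : Sᶜ.map (Function.Embedding.subtype _) = B \ S.map (Function.Embedding.subtype _) := by
    ext v
    simp
    tauto
  unfold SparseCut SparseIn
  rw [edgeWeight_induce, edgeWeight_induce, edgeWeight_induce, h]

theorem form_induce_nonneg [Fintype V] (h : ∀ z : V → ℝ, 0 ≤ ∑ u, ∑ v, z u * G.weight u v * z v)
    (B : Finset V) (z : B → ℝ) : 0 ≤ ∑ u, ∑ v, z u * (G.induce B).weight u v * z v := by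
  have hz := h fun v => if hv : v ∈ B then z ⟨v, hv⟩ else 0
  have hsum : ∀ F : V → ℝ, (∀ v, v ∉ B → F v = 0) → ∑ v, F v = ∑ v : B, F v := by
    intro F hF
    rw [Finset.sum_coe_sort B F]
    exact (Finset.sum_subset (Finset.subset_univ B) fun v _ hv => hF v hv).symm
  rw [hsum _ fun v hv => by simp [hv]] at hz
  refine hz.trans_eq (Finset.sum_congr rfl fun u _ => ?_)
  rw [hsum _ fun v hv => by simp [hv]]
  refine Finset.sum_congr rfl fun v _ => ?_
  simp [induce]

/-- What the search for an expander keeps true of the current set `B`: the part of `A` removed so far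
is light, and few edges leave it. -/
structure IsPruned [Fintype V] (A B : Finset V) : Prop where
  subset : B ⊆ A
  cut : 2 * G.edgeWeight (A \ B) B ≤ G.edgeWeight (A \ B) (A \ B)
  light : 20 * ∑ v ∈ A \ B, G.vertexWeight v ≤ ∑ v ∈ A, G.vertexWeight v

theorem isPruned_self [Fintype V] (A : Finset V) : G.IsPruned A A := by
  refine ⟨subset_rfl, by simp [edgeWeight], ?_⟩
  simpa using Finset.sum_nonneg fun v _ => G.vertexWeight_nonneg v

variable {G}

theorem IsPruned.sum_eq [Fintype V] {A B : Finset V} (h : G.IsPruned A B) :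
    ∑ v ∈ A \ B, G.vertexWeight v + ∑ v ∈ B, G.vertexWeight v = ∑ v ∈ A, G.vertexWeight v :=
  Finset.sum_sdiff h.subset

end WeightedGraph

/-- Without errors the inequality reads 2r(m − r) ≤ r², that is r ≤ 0 or r ≥ 2m/3. Errors below
m²/100 leave the interval (m/20, 0.525m] forbidden. -/
theorem light_of_quadratic {m r α δ : ℝ} (hm : 0 < m) (hm1 : m ≤ 1) (hα : α < m ^ 2 / 100)
    (hδ : δ < m ^ 2 / 100) (hr : r ≤ 0.525 * m)
    (h : 2 * ((r - δ) * (m - r - α)) ≤ r * (r + α) + δ) : r ≤ m / 20 := by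
  by_contra! hlt
  have hm2 : m ^ 2 ≤ m := by nlinarith
  have h1 : (r - 0.01 * m) * (0.99 * m - r) ≤ (r - δ) * (m - r - α) :=
    mul_le_mul (by linarith) (by linarith) (by linarith) (by linarith)
  have h2 : r * α ≤ r * (0.01 * m) := mul_le_mul_of_nonneg_left (by linarith) (by linarith)
  nlinarith [mul_nonneg (by linarith : 0 ≤ r - 0.05 * m) (by linarith : 0 ≤ 0.525 * m - r),
    mul_pos hm hm, mul_pos hm (by linarith : 0 < r)]

namespace BipartiteDist


theorem sum_W_le_one {V₂ V₁ : Type*} [Fintype V₂] {X : BipartiteDist V₂ V₁} (A : Finset V₂) :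
    ∑ v ∈ A, X.W v ≤ 1 := by
  rw [← X.W_mem.2]
  exact Finset.sum_le_sum_of_subset_of_nonneg (Finset.subset_univ A) fun v _ _ => X.W_mem.1 v

variable {V₂ V₁ : Type*} [Fintype V₂] [DecidableEq V₂] [Fintype V₁] {X : BipartiteDist V₂ V₁}
  {α δ : ℝ} {A B : Finset V₂}

/-- The lighter side of a sparse cut may be removed. -/
theorem IsSampler.isPruned_sdiff (hX : X.IsSampler α δ) (hα₀ : 0 ≤ α)
    (hα : α < (∑ v ∈ A, X.W v) ^ 2 / 100) (hδ : δ < (∑ v ∈ A, X.W v) ^ 2 / 100)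
    (hm : 0 < ∑ v ∈ A, X.W v) (hB : X.twoStep.IsPruned A B) {S : Finset V₂} (hS : S ⊆ B)
    (hcut : 2 * X.twoStep.edgeWeight S (B \ S) ≤ X.twoStep.edgeWeight S S)
    (hle : ∑ v ∈ S, X.W v ≤ ∑ v ∈ B \ S, X.W v) : X.twoStep.IsPruned A (B \ S) := by
  have hdisj : Disjoint (A \ B) S :=
    Finset.disjoint_left.2 fun v hv hvS => (Finset.mem_sdiff.1 hv).2 (hS hvS)
  have hsub : B \ S ⊆ A := Finset.sdiff_subset.trans hB.subset
  have hR : A \ (B \ S) = A \ B ∪ S := by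
    ext v
    have := @hB.subset v
    have := @hS v
    simp only [Finset.mem_sdiff, Finset.mem_union]
    tauto
  -- The two inequalities add up: the edges from the old removed part and from S to B∖S are each
  -- paid for by edges inside the new removed part.
  have hcut' : 2 * X.twoStep.edgeWeight (A \ (B \ S)) (B \ S) ≤
      X.twoStep.edgeWeight (A \ (B \ S)) (A \ (B \ S)) := by
    have h1 := X.twoStep.edgeWeight_mono (subset_refl (A \ B)) (Finset.sdiff_subset (s := B) (t := S))
    have h2 := X.twoStep.edgeWeight_mono (subset_refl (A \ B))
      (Finset.subset_union_left (s₁ := A \ B) (s₂ := S))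
    have h3 := X.twoStep.edgeWeight_mono (subset_refl S)
      (Finset.subset_union_right (s₁ := A \ B) (s₂ := S))
    have h4 := hB.cut
    rw [hR, X.twoStep.edgeWeight_union_left hdisj, X.twoStep.edgeWeight_union_left hdisj]
    linarith
  refine ⟨hsub, hcut', ?_⟩
  have hlight := hB.light
  have hsum := hB.sum_eq
  simp only [twoStep_vertexWeight] at hlight hsum ⊢
  have hBS := Finset.sum_sdiff (f := X.W) hS
  have hAB := Finset.sum_sdiff (f := X.W) hsub
  have hr : ∑ v ∈ A \ (B \ S), X.W v = ∑ v ∈ A \ B, X.W v + ∑ v ∈ S, X.W v := by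
    rw [hR, Finset.sum_union hdisj]
  have hm1 := sum_W_le_one (X := X) A
  have hm2 : (∑ v ∈ A, X.W v) ^ 2 ≤ ∑ v ∈ A, X.W v := by nlinarith
  have hlow := (hX.edgeWeight_bounds hα₀ (A \ (B \ S)) (B \ S)).1 (by linarith)
  have hup := (hX.edgeWeight_bounds hα₀ (A \ (B \ S)) (A \ (B \ S))).2
  -- The old part weighs at most m/20 and S at most half of the rest, so together at most 0.525m.
  have := light_of_quadratic hm hm1 hα hδ (r := ∑ v ∈ A \ (B \ S), X.W v) (by linarith) (by
    rw [show ∑ v ∈ A, X.W v - ∑ v ∈ A \ (B \ S), X.W v - α = ∑ v ∈ B \ S, X.W v - α by linarith]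
    linarith)
  linarith

theorem IsSampler.edgeWeight_pos (hX : X.IsSampler α δ) (hα₀ : 0 ≤ α)
    (hα : α < (∑ v ∈ A, X.W v) ^ 2 / 100) (hδ : δ < (∑ v ∈ A, X.W v) ^ 2 / 100)
    (hm : 0 < ∑ v ∈ A, X.W v) (hB : X.twoStep.IsPruned A B) :
    0 < X.twoStep.edgeWeight B B := by
  have hlight := hB.light
  have hsum := hB.sum_eq
  simp only [twoStep_vertexWeight] at hlight hsum
  have hm1 := sum_W_le_one (X := X) A
  have hm2 : (∑ v ∈ A, X.W v) ^ 2 ≤ ∑ v ∈ A, X.W v := by nlinarith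
  refine lt_of_lt_of_le (mul_pos ?_ ?_) ((hX.edgeWeight_bounds hα₀ B B).1 ?_) <;> linarith

end BipartiteDist

/-! ### The search for an induced expander -/

/-- The sum of `a j * w j k * b k` over `j, k < n`. -/
noncomputable def bilinForm (n : ℕ) (w : ℕ → ℕ → ℝ) (a b : ℕ → ℝ) : ℝ :=
  ∑ j ∈ Finset.range n, ∑ k ∈ Finset.range n, a j * w j k * b k

/-- One step of the random walk on the set with indicator function `b`. -/
noncomputable def walkStep (n : ℕ) (w : ℕ → ℕ → ℝ) (b x : ℕ → ℝ) (v : ℕ) : ℝ :=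
  (∑ k ∈ Finset.range n, b v * w v k * b k * x k) / ∑ k ∈ Finset.range n, b v * w v k * b k

/-- The indicator function of the single index `i`. -/
noncomputable def startVector (i v : ℕ) : ℝ := if v < i then 0 else if i < v then 0 else 1

/-- The column `i` of the `k`-th power of the random walk. -/
noncomputable def walkVector (n : ℕ) (w : ℕ → ℕ → ℝ) (b : ℕ → ℝ) (i k : ℕ) : ℕ → ℝ :=
  (walkStep n w b)^[k] (startVector i)

/-- The part of the set with indicator function `b` on which `x` is at least `x u`. -/
noncomputable def sweepVector (b x : ℕ → ℝ) (u j : ℕ) : ℝ := if x u ≤ x j then b j else 0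

/-- The set with indicator function `b` without the lighter side of the cut `s`, if `s` is sparse. -/
noncomputable def cutVector (n : ℕ) (w : ℕ → ℕ → ℝ) (b s : ℕ → ℝ) (v : ℕ) : ℝ :=
  if bilinForm n w s s ≤
      bilinForm n w s (fun k => b k - s k) + bilinForm n w s (fun k => b k - s k) then b v
  else if bilinForm n w (fun k => b k - s k) (fun k => b k - s k) ≤
      bilinForm n w s (fun k => b k - s k) + bilinForm n w s (fun k => b k - s k) then b v
  else if bilinForm n w s (fun _ => 1) ≤ bilinForm n w (fun k => b k - s k) (fun _ => 1) then
    b v - s v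
  else s v

/-- Assign `f 0, …, f (n - 1)` to column `0` of the array `a`. -/
def assign (n a : ℕ) (f : ℕ → ℝ) (A : Arrays) : Arrays :=
  Function.update A a fun v j => if v < n ∧ j = 0 then f v else A a v j

/-- Assign the indicator function of `i` to array `2`. -/
noncomputable def startCmd (n i : ℕ) (A : Arrays) : Arrays := assign n 2 (startVector i) A

/-- Apply a step of the random walk to array `2`. -/
noncomputable def walkCmd (n : ℕ) (A : Arrays) : Arrays :=
  assign n 2 (walkStep n (A 0) (fun j => A 1 j 0) fun j => A 2 j 0) A

/-- Cut the set in array `1` along the sweep cut of array `2` at `u`, if that is sparse. -/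
noncomputable def cutCmd (n u : ℕ) (A : Arrays) : Arrays :=
  assign n 1 (cutVector n (A 0) (fun j => A 1 j 0)
    (sweepVector (fun j => A 1 j 0) (fun j => A 2 j 0) u)) A

/-- Compute a column of a high power of the random walk and try all its sweep cuts. -/
noncomputable def columnCmd (n i : ℕ) (A : Arrays) : Arrays :=
  countFold (cutCmd n) ((walkCmd n)^[100 * n] (startCmd n i A)) n

/-- Try the sweep cuts of all columns, `n` times. -/
noncomputable def searchCmd (n : ℕ) (A : Arrays) : Arrays :=
  (fun A => countFold (columnCmd n) A n)^[n] A

/-! ### The search is computable in polynomial time -/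

/-- Register 5 holds the sweep index and register 6 the entry being assigned, which leaves 7 and 8
for the two summations. -/
theorem bilinForm_computable {a b : Arrays → ℕ → ℕ → ℝ}
    (ha : ∀ d k, 5 < d → k < d → ExprComputable d fun ρ A => a A (ρ 5) (ρ k))
    (hb : ∀ d k, 5 < d → k < d → ExprComputable d fun ρ A => b A (ρ 5) (ρ k)) :
    ExprComputable 7 fun ρ A => bilinForm (ρ 0) (A 0) (a A (ρ 5)) (b A (ρ 5)) := by
  have := ExprComputable.sum (d := 7) (ExprComputable.sum (d := 8)
    (((ha 9 7 (by omega) (by omega)).mul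
      (ExprComputable.cell 0 7 8 (by omega) (by omega) (by omega))).mul
        (hb 9 8 (by omega) (by omega))))
  simpa [Function.update_apply, bilinForm] using this

theorem cutCmd_computable : CmdComputable 6 fun ρ A => cutCmd (ρ 0) (ρ 5) A := by
  have hb : ∀ d k, 5 < d → k < d → ExprComputable d fun ρ A => A 1 (ρ k) 0 :=
    fun d k _ hk => .cell_zero 1 k (by omega) hk
  have hs : ∀ d k, 5 < d → k < d → ExprComputable d fun ρ A =>
      sweepVector (fun j => A 1 j 0) (fun j => A 2 j 0) (ρ 5) (ρ k) := fun d k hd hk =>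
    .iteLe (.cell_zero 2 5 (by omega) hd) (.cell_zero 2 k (by omega) hk) (hb d k hd hk) .zero
  have hr := fun d k hd hk => (hb d k hd hk).sub (hs d k hd hk)
  have h1 : ∀ d k, 5 < d → k < d → ExprComputable d fun _ _ => (1 : ℝ) :=
    fun _ _ _ _ => .one
  have hsr := bilinForm_computable
    (a := fun A u => sweepVector (fun j => A 1 j 0) (fun j => A 2 j 0) u)
    (b := fun A u j => A 1 j 0 - sweepVector (fun j => A 1 j 0) (fun j => A 2 j 0) u j) hs hr
  have hss := bilinForm_computable
    (a := fun A u => sweepVector (fun j => A 1 j 0) (fun j => A 2 j 0) u)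
    (b := fun A u => sweepVector (fun j => A 1 j 0) (fun j => A 2 j 0) u) hs hs
  have hrr := bilinForm_computable
    (a := fun A u j => A 1 j 0 - sweepVector (fun j => A 1 j 0) (fun j => A 2 j 0) u j)
    (b := fun A u j => A 1 j 0 - sweepVector (fun j => A 1 j 0) (fun j => A 2 j 0) u j) hr hr
  have hs1 := bilinForm_computable
    (a := fun A u => sweepVector (fun j => A 1 j 0) (fun j => A 2 j 0) u)
    (b := fun _ _ _ => 1) hs h1
  have hr1 := bilinForm_computable
    (a := fun A u j => A 1 j 0 - sweepVector (fun j => A 1 j 0) (fun j => A 2 j 0) u j)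
    (b := fun _ _ _ => 1) hr h1
  have key := CmdComputable.vec (d := 6) 1 (by omega)
    (.iteLe hss (hsr.add hsr) (hb 7 6 (by omega) (by omega))
      (.iteLe hrr (hsr.add hsr) (hb 7 6 (by omega) (by omega))
        (.iteLe hs1 hr1 (hr 7 6 (by omega) (by omega)) (hs 7 6 (by omega) (by omega)))))
  refine key.congr ?_
  funext ρ A
  simp [cutCmd, assign, cutVector]

theorem walkCmd_computable : CmdComputable 6 fun ρ A => walkCmd (ρ 0) A := by
  have hw : ExprComputable 8 fun ρ A => A 1 (ρ 6) 0 * A 0 (ρ 6) (ρ 7) * A 1 (ρ 7) 0 :=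
    ((ExprComputable.cell_zero 1 6 (by omega) (by omega)).mul
      (.cell 0 6 7 (by omega) (by omega) (by omega))).mul (.cell_zero 1 7 (by omega) (by omega))
  have key := CmdComputable.vec (d := 6) 2 (by omega)
    ((ExprComputable.sum (d := 7) (hw.mul (.cell_zero 2 7 (by omega) (by omega)))).div
      (ExprComputable.sum (d := 7) hw))
  refine key.congr ?_
  funext ρ A
  simp [walkCmd, assign, walkStep]

theorem startCmd_computable : CmdComputable 5 fun ρ A => startCmd (ρ 0) (ρ 4) A := by
  have key := CmdComputable.vec (d := 5) 2 (by omega)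
    (.iteLt 5 4 (by omega) (by omega) .zero (.iteLt 4 5 (by omega) (by omega) .zero .one))
  refine key.congr ?_
  funext ρ A
  simp [startCmd, assign, startVector]

theorem columnCmd_computable : CmdComputable 5 fun ρ A => columnCmd (ρ 0) (ρ 4) A := by
  -- The 100n walk steps are a loop over n whose body is unrolled 100 times.
  have key := (startCmd_computable.seq
    (CmdComputable.count (walkCmd_computable.iterate 100))).seq
      (CmdComputable.count cutCmd_computable)
  refine key.congr ?_
  funext ρ A
  have h0 : ∀ j, Function.update ρ 5 j 0 = ρ 0 := fun j => by simp
  have h5 : ∀ j, Function.update ρ 5 j 5 = j := fun j => by simp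
  simp only [columnCmd, h0, h5, countFold_const, Function.iterate_mul]

theorem searchCmd_computable : CmdComputable 3 fun ρ A => searchCmd (ρ 0) A := by
  have key := CmdComputable.count (d := 3) (CmdComputable.count (d := 4) columnCmd_computable)
  refine key.congr ?_
  funext ρ A
  simp [searchCmd, countFold_const]

/-! ### Correctness of the search -/

section Vectors

variable {V : Type*} {n : ℕ}

open Classical in
/-- The indicator function of a vertex set, in terms of a numbering of the vertices. -/
noncomputable def indicatorVector (e : V ≃ Fin n) (B : Finset V) (j : ℕ) : ℝ :=
  if h : j < n then (if e.symm ⟨j, h⟩ ∈ B then 1 else 0) else 0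

/-- The edge weights in terms of a numbering of the vertices. -/
noncomputable def weightArray (e : V ≃ Fin n) (G : WeightedGraph V) (i j : ℕ) : ℝ :=
  if h : i < n ∧ j < n then G.weight (e.symm ⟨i, h.1⟩) (e.symm ⟨j, h.2⟩) else 0

theorem indicatorVector_apply [DecidableEq V] (e : V ≃ Fin n) (B : Finset V) (v : V) :
    indicatorVector e B (e v) = if v ∈ B then 1 else 0 := by
  simp [indicatorVector]

theorem weightArray_apply (e : V ≃ Fin n) (G : WeightedGraph V) (u v : V) :
    weightArray e G (e u) (e v) = G.weight u v := by
  simp [weightArray]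

theorem eq_indicatorVector [DecidableEq V] (e : V ≃ Fin n) (B : Finset V) (b : ℕ → ℝ)
    (h : ∀ v, b (e v) = if v ∈ B then 1 else 0) (h' : ∀ j, n ≤ j → b j = 0) :
    b = indicatorVector e B := by
  funext j
  by_cases hj : j < n
  · have := h (e.symm ⟨j, hj⟩)
    rw [← indicatorVector_apply e B] at this
    simpa using this
  · rw [h' j (by omega)]
    simp [indicatorVector, hj]

theorem sum_range_eq [Fintype V] (e : V ≃ Fin n) (F : ℕ → ℝ) :
    ∑ j ∈ Finset.range n, F j = ∑ v, F (e v) := by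
  rw [Finset.sum_range]
  exact (Equiv.sum_comp e fun j => F j).symm

theorem bilinForm_eq [Fintype V] [DecidableEq V] (e : V ≃ Fin n) (G : WeightedGraph V)
    {a b : ℕ → ℝ} {S T : Finset V} (ha : ∀ v, a (e v) = if v ∈ S then 1 else 0)
    (hb : ∀ v, b (e v) = if v ∈ T then 1 else 0) :
    bilinForm n (weightArray e G) a b = G.edgeWeight S T := by
  unfold bilinForm WeightedGraph.edgeWeight
  simp only [sum_range_eq e, weightArray_apply, ha, hb]
  simp

end Vectors

/-! ### A single cut of the current set -/

namespace WeightedGraph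

variable {V : Type*} [Fintype V] (G : WeightedGraph V)

theorem sum_vertexWeight_eq_edgeWeight_univ (S : Finset V) :
    ∑ v ∈ S, G.vertexWeight v = G.edgeWeight S Finset.univ := rfl

variable [DecidableEq V]

open Classical in
/-- The set `B` without the lighter side of the cut `S`, if that is sparse. -/
noncomputable def cutStep (B S : Finset V) : Finset V :=
  if G.SparseIn B S then
    if ∑ v ∈ S, G.vertexWeight v ≤ ∑ v ∈ B \ S, G.vertexWeight v then B \ S else S
  else B

theorem cutStep_subset {B S : Finset V} (hS : S ⊆ B) : G.cutStep B S ⊆ B := by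
  unfold cutStep
  split_ifs
  exacts [Finset.sdiff_subset, hS, subset_rfl]

/-- The strict inequalities force positive edge weight inside both sides, so neither is empty. -/
theorem card_cutStep_lt {B S : Finset V} (hS : S ⊆ B) (h : G.SparseIn B S) :
    (G.cutStep B S).card < B.card := by
  have h0 := G.edgeWeight_nonneg S (B \ S)
  have hne : S.Nonempty := by
    rw [Finset.nonempty_iff_ne_empty]
    rintro rfl
    have := h.1
    simp [edgeWeight] at this
  have hne' : (B \ S).Nonempty := by
    rw [Finset.nonempty_iff_ne_empty]
    intro he
    have := h.2
    rw [he] at this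
    simp [edgeWeight] at this
  have hcard := Finset.card_sdiff_add_card_eq_card hS
  have := hne.card_pos
  have := hne'.card_pos
  unfold cutStep
  rw [if_pos h]
  split_ifs <;> omega

theorem cutVector_eq {n : ℕ} (e : V ≃ Fin n) {s : ℕ → ℝ} {B S : Finset V} (hS : S ⊆ B)
    (hs : ∀ v, s (e v) = if v ∈ S then 1 else 0) (v : V) :
    cutVector n (weightArray e G) (indicatorVector e B) s (e v) =
      if v ∈ G.cutStep B S then 1 else 0 := by
  have hr : ∀ v, indicatorVector e B (e v) - s (e v) = if v ∈ B \ S then 1 else 0 := by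
    intro v
    rw [indicatorVector_apply, hs]
    by_cases h1 : v ∈ S
    · simp [h1, hS h1]
    · simp [h1]
  have h1 : ∀ v : V, (fun _ : ℕ => (1 : ℝ)) (e v) = if v ∈ Finset.univ then 1 else 0 := by simp
  unfold cutVector cutStep SparseIn
  rw [bilinForm_eq e G hs hs, bilinForm_eq e G hs hr, bilinForm_eq e G hr hr,
    bilinForm_eq e G hs h1, bilinForm_eq e G hr h1, hr, hs, indicatorVector_apply,
    sum_vertexWeight_eq_edgeWeight_univ, sum_vertexWeight_eq_edgeWeight_univ, ← two_mul]
  by_cases c1 : G.edgeWeight S S ≤ 2 * G.edgeWeight S (B \ S)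
  · simp only [if_pos c1, not_lt.2 c1, false_and, if_false]
  by_cases c2 : G.edgeWeight (B \ S) (B \ S) ≤ 2 * G.edgeWeight S (B \ S)
  · simp only [if_neg c1, if_pos c2, not_lt.2 c2, and_false, if_false]
  simp only [if_neg c1, if_neg c2, if_pos (And.intro (not_le.1 c1) (not_le.1 c2))]
  by_cases c3 : G.edgeWeight S Finset.univ ≤ G.edgeWeight (B \ S) Finset.univ
  · rw [if_pos c3, if_pos c3]
  · rw [if_neg c3, if_neg c3]

end WeightedGraph

/-! ### Sweep sets and the walk on the current set -/

section Sweep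

variable {V : Type*} {n : ℕ} (e : V ≃ Fin n) (G : WeightedGraph V)

open Classical in
/-- The vertices of `B` at which `x` is at least `x u`. -/
noncomputable def sweepSet (B : Finset V) (x : ℕ → ℝ) (u : ℕ) : Finset V :=
  B.filter fun v => x u ≤ x (e v)

theorem sweepSet_subset (B : Finset V) (x : ℕ → ℝ) (u : ℕ) : sweepSet e B x u ⊆ B :=
  Finset.filter_subset _ _

theorem sweepSet_congr {B : Finset V} {x y : ℕ → ℝ} {u : ℕ} (hu : u < n)
    (h : ∀ j < n, x j = y j) : sweepSet e B x u = sweepSet e B y u := by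
  unfold sweepSet
  simp only [h u hu, h _ (e _).isLt]

theorem sweepVector_eq [DecidableEq V] (B : Finset V) (x : ℕ → ℝ) (u : ℕ) (v : V) :
    sweepVector (indicatorVector e B) x u (e v) = if v ∈ sweepSet e B x u then 1 else 0 := by
  unfold sweepVector sweepSet
  rw [indicatorVector_apply]
  by_cases h : x u ≤ x (e v) <;> simp [h]

variable [Fintype V] [DecidableEq V]

/-- No sweep cut of a column of a high power of the random walk on `B` is sparse. -/
def NoSparseSweep (B : Finset V) : Prop :=
  ∀ i < n, ∀ u < n, ¬ G.SparseIn B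
    (sweepSet e B (walkVector n (weightArray e G) (indicatorVector e B) i (100 * n)) u)

/-- The factor `b k` in numerator and denominator confines the walk to B, so values outside B never
influence those inside. -/
theorem walkVector_eq (B : Finset V) (i : B) (k : ℕ) (v : B) :
    walkVector n (weightArray e G) (indicatorVector e B) (e i) k (e v) =
      ((G.induce B).walkMatrix ^ k) v i := by
  induction k generalizing v with
  | zero =>
    simp only [walkVector, Function.iterate_zero, id, startVector, pow_zero, Matrix.one_apply]
    by_cases h : v = i
    · simp [h]
    · have h' : ((e v : Fin n) : ℕ) ≠ (e i : Fin n) := by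
        intro hc
        exact h (Subtype.ext (e.injective (Fin.ext hc)))
      rcases lt_or_gt_of_ne h' with hl | hl
      · simp [h, hl]
      · simp [h, hl]
  | succ k ih =>
    have hB : ∀ F : V → ℝ, ∑ u, (if u ∈ B then F u else 0) = ∑ u : B, F u := by
      intro F
      rw [Finset.sum_coe_sort B F, ← Finset.sum_filter, Finset.filter_mem_eq_inter,
        Finset.univ_inter]
    unfold walkVector at ih ⊢
    rw [Function.iterate_succ_apply', walkStep, sum_range_eq e, sum_range_eq e, pow_succ',
      Matrix.mul_apply]
    simp only [indicatorVector_apply, weightArray_apply, v.2, if_true, one_mul, mul_ite, mul_one,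
      mul_zero, ite_mul, zero_mul, hB, ih]
    rw [Finset.sum_div]
    refine Finset.sum_congr rfl fun u _ => ?_
    simp only [WeightedGraph.walkMatrix, WeightedGraph.vertexWeight, WeightedGraph.induce,
      Matrix.of_apply]
    ring

theorem NoSparseSweep.lam_le {e : V ≃ Fin n} {G : WeightedGraph V} {B : Finset V}
    (h : NoSparseSweep e G B) (hG : ∀ z : V → ℝ, 0 ≤ ∑ u, ∑ v, z u * G.weight u v * z v)
    (hB : 0 < G.edgeWeight B B) : (G.induce B).lam ≤ 99 / 100 := by
  have hcard : Fintype.card V = n := by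
    rw [Fintype.card_congr e, Fintype.card_fin]
  have hBn : Fintype.card B ≤ n := by
    rw [Fintype.card_coe, ← hcard]
    exact Finset.card_le_univ B
  have hn : 0 < n := by
    rcases Nat.eq_zero_or_pos n with rfl | hn
    · have : B = ∅ := by
        rw [← Finset.card_eq_zero, ← Fintype.card_coe]
        omega
      rw [this] at hB
      simp [WeightedGraph.edgeWeight] at hB
    · exact hn
  refine (G.induce B).lam_le_of_no_sparse_sweep (G.form_induce_nonneg hG B)
    (by rwa [G.sum_vertexWeight_induce]) n hn hBn fun i u hcut => ?_
  refine h (e i) (e i).isLt (e u) (e u).isLt ?_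
  have := (G.sparseCut_induce B (Finset.univ.filter fun v =>
    ((G.induce B).walkMatrix ^ (100 * n)) u i ≤ ((G.induce B).walkMatrix ^ (100 * n)) v i)).1
      (by convert hcut)
  convert this using 1
  ext v
  simp only [sweepSet, Finset.mem_filter, Finset.mem_map, Finset.mem_univ, true_and,
    Function.Embedding.subtype_apply, Subtype.exists, exists_and_right, exists_eq_right]
  constructor
  · rintro ⟨hv, hle⟩
    refine ⟨hv, ?_⟩
    rw [← walkVector_eq e G B i _ u, ← walkVector_eq e G B i _ ⟨v, hv⟩]
    exact hle
  · rintro ⟨hv, hle⟩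
    refine ⟨hv, ?_⟩
    rw [← walkVector_eq e G B i _ u, ← walkVector_eq e G B i _ ⟨v, hv⟩] at hle
    exact hle

end Sweep

/-! ### Invariants of the search -/

section Commands

variable {V : Type*} [Fintype V] [DecidableEq V] {n : ℕ} {e : V ≃ Fin n} {G : WeightedGraph V}
  {A : Arrays} {B : Finset V}

/-- The arrays hold the edge weights of `G` and the indicator function of `B`. -/
structure Stores (e : V ≃ Fin n) (G : WeightedGraph V) (A : Arrays) (B : Finset V) : Prop where
  weight : A 0 = weightArray e G
  set : (fun j => A 1 j 0) = indicatorVector e B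

theorem walkStep_congr {n : ℕ} {w : ℕ → ℕ → ℝ} {b x y : ℕ → ℝ} (h : ∀ j < n, x j = y j) (v : ℕ) :
    walkStep n w b x v = walkStep n w b y v := by
  unfold walkStep
  congr 1
  exact Finset.sum_congr rfl fun l hl => by rw [h l (Finset.mem_range.1 hl)]

theorem walkCmd_iterate (n i k : ℕ) (A : Arrays) :
    (walkCmd n)^[k] (startCmd n i A) 0 = A 0 ∧ (walkCmd n)^[k] (startCmd n i A) 1 = A 1 ∧
      ∀ j < n, (walkCmd n)^[k] (startCmd n i A) 2 j 0 =
        walkVector n (A 0) (fun j => A 1 j 0) i k j := by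
  induction k with
  | zero =>
    refine ⟨by simp [startCmd, assign], by simp [startCmd, assign], fun j hj => ?_⟩
    simp [startCmd, assign, walkVector, hj]
  | succ k ih =>
    obtain ⟨h0, h1, h2⟩ := ih
    rw [Function.iterate_succ_apply']
    refine ⟨by simpa [walkCmd, assign] using h0, by simpa [walkCmd, assign] using h1,
      fun j hj => ?_⟩
    unfold walkVector at h2 ⊢
    rw [Function.iterate_succ_apply']
    simp only [walkCmd, assign, Function.update_self, hj, true_and, if_true, h0, h1]
    exact walkStep_congr h2 j

theorem Stores.cutCmd (h : Stores e G A B) (u : ℕ) :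
    Stores e G (cutCmd n u A) (G.cutStep B (sweepSet e B (fun j => A 2 j 0) u)) := by
  refine ⟨by simpa [InducedExpander.cutCmd, assign] using h.weight, ?_⟩
  refine eq_indicatorVector e _ _ (fun v => ?_) fun j hj => ?_
  · have := G.cutVector_eq e (sweepSet_subset e B (fun j => A 2 j 0) u)
      (sweepVector_eq e B (fun j => A 2 j 0) u) v
    simp only [InducedExpander.cutCmd, assign, Function.update_self, (e v).isLt, true_and, if_true,
      h.weight, h.set, this]
  · have := congrFun h.set j
    simp only [InducedExpander.cutCmd, assign, Function.update_self, not_lt.2 hj, false_and,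
      if_false]
    rw [this]
    simp [indicatorVector, not_lt.2 hj]

/-- The state of a search that has started from `B₀`: the current set satisfies `I`, and either it
still is `B₀` and `D` holds, or `B₀` had a sparse sweep cut and the set has become smaller. -/
def Progress (e : V ≃ Fin n) (G : WeightedGraph V) (I : Finset V → Prop) (B₀ : Finset V) (D : Prop)
    (A : Arrays) : Prop :=
  ∃ B, Stores e G A B ∧ I B ∧
    (B = B₀ ∧ D ∨ B.card < B₀.card ∧ ¬ NoSparseSweep e G B₀)

theorem Progress.columnCmd {I : Finset V → Prop}
    (hI : ∀ B S, I B → S ⊆ B → I (G.cutStep B S)) {B₀ : Finset V} {D : Prop} {i : ℕ} (hi : i < n)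
    (h : Progress e G I B₀ D A) :
    Progress e G I B₀ (D ∧ ∀ u < n, ¬ G.SparseIn B₀ (sweepSet e B₀
      (walkVector n (weightArray e G) (indicatorVector e B₀) i (100 * n)) u))
      (columnCmd n i A) := by
  obtain ⟨B₁, hst, hI₁, hB₁⟩ := h
  obtain ⟨h0, h1, h2⟩ := walkCmd_iterate n i (100 * n) A
  rw [hst.weight, hst.set] at h2
  set x := walkVector n (weightArray e G) (indicatorVector e B₁) i (100 * n)
  have key := countFold_induction (F := InducedExpander.cutCmd n)
    (A := (walkCmd n)^[100 * n] (startCmd n i A))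
    -- After a first cut `x` is no longer a walk vector of the current set. Further sweeps are
    -- harmless: any cut step preserves I and never enlarges the set.
    (fun u A' => (∀ j < n, A' 2 j 0 = x j) ∧ ∃ B, Stores e G A' B ∧ I B ∧
      (B = B₀ ∧ B₁ = B₀ ∧ D ∧ (∀ u' < u, ¬ G.SparseIn B₀ (sweepSet e B₀ x u')) ∨
        B.card < B₀.card ∧ ¬ NoSparseSweep e G B₀))
    ⟨h2, B₁, ⟨h0.trans hst.weight, by rw [h1]; exact hst.set⟩, hI₁, by
      rcases hB₁ with ⟨rfl, hD⟩ | hB₁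
      · exact Or.inl ⟨rfl, rfl, hD, by simp⟩
      · exact Or.inr hB₁⟩ n
    (fun u hu A' hA' => by
      obtain ⟨hx, B, hB, hIB, hcase⟩ := hA'
      refine ⟨fun j hj => by simpa [InducedExpander.cutCmd, assign] using hx j hj, _,
        hB.cutCmd u, hI _ _ hIB (sweepSet_subset e _ _ _), ?_⟩
      rw [sweepSet_congr e hu hx]
      have hsub := sweepSet_subset e B x u
      rcases hcase with ⟨rfl, rfl, hD, hall⟩ | ⟨hlt, hno⟩
      · by_cases hs : G.SparseIn B₁ (sweepSet e B₁ x u)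
        · exact Or.inr ⟨G.card_cutStep_lt hsub hs, fun hc => hc i hi u hu hs⟩
        · refine Or.inl ⟨by simp [WeightedGraph.cutStep, hs], rfl, hD, fun u' hu' => ?_⟩
          rcases Nat.lt_succ_iff_lt_or_eq.1 hu' with h | rfl
          · exact hall u' h
          · exact hs
      · exact Or.inr ⟨(Finset.card_le_card (G.cutStep_subset hsub)).trans_lt hlt, hno⟩)
  obtain ⟨-, B, hB, hIB, hcase⟩ := key
  refine ⟨B, hB, hIB, ?_⟩
  rcases hcase with ⟨rfl, rfl, hD, hall⟩ | hcase
  · exact Or.inl ⟨rfl, hD, hall⟩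
  · exact Or.inr hcase

/-- Each round that does not end in a good set removes a vertex, and a good set is never changed.
After n rounds a set that is not good would be empty, which I excludes. -/
theorem searchCmd_spec {I : Finset V → Prop} (hI : ∀ B S, I B → S ⊆ B → I (G.cutStep B S))
    (hne : ¬ I ∅) (h : Stores e G A B) (hB : I B) :
    ∃ B', Stores e G (searchCmd n A) B' ∧ I B' ∧ NoSparseSweep e G B' := by
  have hcard : B.card ≤ n := by
    rw [← Fintype.card_fin n, ← Fintype.card_congr e]
    exact Finset.card_le_univ B
  have key : ∀ m, ∃ B', Stores e G ((fun A => countFold (columnCmd n) A n)^[m] A) B' ∧ I B' ∧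
      (NoSparseSweep e G B' ∨ B'.card + m ≤ n) := by
    intro m
    induction m with
    | zero => exact ⟨B, h, hB, Or.inr hcard⟩
    | succ m ih =>
      obtain ⟨B₀, hst, hI₀, hcase⟩ := ih
      rw [Function.iterate_succ_apply']
      obtain ⟨B', hst', hI', hB'⟩ := countFold_induction (F := columnCmd n)
        (fun i A => Progress e G I B₀ (∀ i' < i, ∀ u < n, ¬ G.SparseIn B₀ (sweepSet e B₀
          (walkVector n (weightArray e G) (indicatorVector e B₀) i' (100 * n)) u)) A)
        (A := (fun A => countFold (columnCmd n) A n)^[m] A)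
        ⟨B₀, hst, hI₀, Or.inl ⟨rfl, by simp⟩⟩ n (fun i hi A' hA' => by
          obtain ⟨B', hst', hI', hB'⟩ := hA'.columnCmd hI hi
          refine ⟨B', hst', hI', hB'.imp_left fun h => ⟨h.1, fun i' hi' => ?_⟩⟩
          rcases Nat.lt_succ_iff_lt_or_eq.1 hi' with hlt | rfl
          · exact h.2.1 i' hlt
          · exact h.2.2)
      refine ⟨B', hst', hI', ?_⟩
      rcases hB' with ⟨rfl, hgood⟩ | ⟨hlt, hno⟩
      · exact Or.inl hgood
      · rcases hcase with hcase | hcase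
        · exact absurd hcase hno
        · right; omega
  obtain ⟨B', hst, hI', hcase⟩ := key n
  refine ⟨B', hst, hI', hcase.resolve_right fun hc => hne ?_⟩
  have : B' = ∅ := Finset.card_eq_zero.1 (by omega)
  rwa [← this]

end Commands

/-! ### The program and its guarantee -/

theorem CmdComputable.exists_prog {F : (ℕ → ℕ) → Arrays → Arrays} (hF : CmdComputable 3 F) :
    ∃ (P : Prog) (p : Polynomial ℕ), ∀ σ : State, σ.idx 2 = 0 →
      ∃ t τ, Exec P σ t τ ∧ t ≤ p.eval (σ.idx 0) ∧ τ.arr 1 = F (σ.setIdx 1 1).idx σ.arr 1 := by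
  obtain ⟨P, p, hP⟩ := hF le_rfl
  refine ⟨.seq (.instr (.idxConst 1 1)) P, 1 + p, fun σ h2 => ?_⟩
  obtain ⟨t, τ, hE, ht, -, hv⟩ := hP (σ.setIdx 1 1) (σ.setIdx 1 1) (by simp [State.setIdx])
    (by simpa [State.setIdx] using h2) (AgreeBelow.refl _ _ _)
  refine ⟨1 + t, τ, .seq (.instr _ _) hE, ?_, hv 1 (by omega)⟩
  rw [Polynomial.eval_add, Polynomial.eval_one]
  exact Nat.add_le_add_left ht 1

theorem inputState_stores {V : Type*} [Fintype V] [DecidableEq V] {n : ℕ} (e : V ≃ Fin n)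
    (G : WeightedGraph V) (A : Finset V) : Stores e G (inputState e G A).arr A := by
  refine ⟨?_, ?_⟩
  · funext i j
    simp [inputState, weightArray]
  · funext j
    simp [inputState, indicatorVector]

namespace BipartiteDist

variable {V₂ V₁ : Type*} [Fintype V₂] [DecidableEq V₂] [Fintype V₁] {X : BipartiteDist V₂ V₁}
  {α δ : ℝ} {A : Finset V₂}

theorem IsSampler.isPruned_cutStep (hX : X.IsSampler α δ) (hα₀ : 0 ≤ α)
    (hα : α < (∑ v ∈ A, X.W v) ^ 2 / 100) (hδ : δ < (∑ v ∈ A, X.W v) ^ 2 / 100)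
    (hm : 0 < ∑ v ∈ A, X.W v) {B S : Finset V₂} (hB : X.twoStep.IsPruned A B) (hS : S ⊆ B) :
    X.twoStep.IsPruned A (X.twoStep.cutStep B S) := by
  unfold WeightedGraph.cutStep
  simp only [twoStep_vertexWeight]
  split_ifs with h1 h2
  · exact hX.isPruned_sdiff hα₀ hα hδ hm hB hS h1.1.le h2
  -- Sparsity is symmetric in the two sides, so keeping S is the removal of the cut B∖S.
  · have := hX.isPruned_sdiff hα₀ hα hδ hm hB (S := B \ S) Finset.sdiff_subset
    rw [Finset.sdiff_sdiff_eq_self hS, X.twoStep.edgeWeight_comm (B \ S) S] at this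
    exact this h1.2.le (not_le.1 h2).le
  · exact hB

end BipartiteDist

theorem exists_search_prog :
    ∃ (P : Prog) (p : Polynomial ℕ),
      ∀ (V₂ : Type u) (V₁ : Type v) [Fintype V₂] [Fintype V₁] (n : ℕ) (e : V₂ ≃ Fin n)
        (α β δ : ℝ) (X : BipartiteDist V₂ V₁) (A : Finset V₂),
      α ∈ Set.Ioo (0 : ℝ) 1 → β ∈ Set.Ioo (0 : ℝ) 1 → δ ∈ Set.Ioo (0 : ℝ) 1 →
      α < β ^ 2 / 100 → δ < β ^ 2 / 100 →
      X.IsSampler α δ →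
      β ≤ X.twoStep.measure A →
      ∃ (t : ℕ) (τ : State) (B : Finset V₂),
        Exec P (inputState e X.twoStep A) t τ ∧ t ≤ p.eval n ∧ Outputs e τ B ∧
        B ⊆ A ∧ β / 4 ≤ X.twoStep.measure B ∧ (X.twoStep.induce B).lam ≤ 99 / 100 := by
  obtain ⟨P, p, hP⟩ := searchCmd_computable.exists_prog
  refine ⟨P, p, fun V₂ V₁ _ _ n e α β δ X A hα hβ _ hαβ hδβ hX hA => ?_⟩
  classical
  obtain ⟨t, τ, hE, ht, hτ⟩ := hP (inputState e X.twoStep A) (by simp [inputState])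
  rw [BipartiteDist.twoStep_measure] at hA
  have hm : 0 < ∑ v ∈ A, X.W v := hβ.1.trans_le hA
  have hsq : β ^ 2 ≤ (∑ v ∈ A, X.W v) ^ 2 := pow_le_pow_left₀ hβ.1.le hA 2
  have hα' : α < (∑ v ∈ A, X.W v) ^ 2 / 100 := by linarith
  have hδ' : δ < (∑ v ∈ A, X.W v) ^ 2 / 100 := by linarith
  have hpos := fun B => hX.edgeWeight_pos (B := B) hα.1.le hα' hδ' hm
  obtain ⟨B, hst, hB, hgood⟩ := searchCmd_spec (I := X.twoStep.IsPruned A)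
    (fun B S hB hS => hX.isPruned_cutStep hα.1.le hα' hδ' hm hB hS)
    -- A pruned set has positive internal edge weight, so the empty set is not pruned.
    (fun h => (hpos ∅ h).ne' (by simp [WeightedGraph.edgeWeight]))
    (inputState_stores e X.twoStep A) (X.twoStep.isPruned_self A)
  refine ⟨t, τ, B, hE, by simpa [inputState] using ht, fun v => ?_, hB.subset, ?_,
    hgood.lam_le X.twoStep_form_nonneg (hpos B hB)⟩
  · have := congrFun hst.set (e v)
    rw [indicatorVector_apply] at this
    rw [hτ, show ((inputState e X.twoStep A).setIdx 1 1).idx 0 = n by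
      simp [inputState, State.setIdx], this]
  -- Lightness of the removed part even leaves 19/20 of the weight of A.
  · have hsum := hB.sum_eq
    have hlight := hB.light
    simp only [BipartiteDist.twoStep_vertexWeight] at hsum hlight
    rw [BipartiteDist.twoStep_measure]
    linarith

end InducedExpander

theorem theorem2p7 :
    -- existence
    (∀ (V₂ : Type u) (V₁ : Type v) [Fintype V₂] [Fintype V₁] (α β δ : ℝ)
        (X : BipartiteDist V₂ V₁) (A : Finset V₂),
      α ∈ Set.Ioo (0 : ℝ) 1 → β ∈ Set.Ioo (0 : ℝ) 1 → δ ∈ Set.Ioo (0 : ℝ) 1 →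
      α < β ^ 2 / 100 → δ < β ^ 2 / 100 →
      X.IsSampler α δ →
      β ≤ X.twoStep.measure A →
      ∃ B ⊆ A, β / 4 ≤ X.twoStep.measure B ∧ (X.twoStep.induce B).lam ≤ 99 / 100) ∧
    -- one program finds such a set in polynomially many steps, from the weighted graph and `A`
    (∃ (P : Prog) (p : Polynomial ℕ),
      ∀ (V₂ : Type u) (V₁ : Type v) [Fintype V₂] [Fintype V₁] (n : ℕ) (e : V₂ ≃ Fin n)
        (α β δ : ℝ) (X : BipartiteDist V₂ V₁) (A : Finset V₂),
      α ∈ Set.Ioo (0 : ℝ) 1 → β ∈ Set.Ioo (0 : ℝ) 1 → δ ∈ Set.Ioo (0 : ℝ) 1 →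
      α < β ^ 2 / 100 → δ < β ^ 2 / 100 →
      X.IsSampler α δ →
      β ≤ X.twoStep.measure A →
      ∃ (t : ℕ) (τ : State) (B : Finset V₂),
        Exec P (inputState e X.twoStep A) t τ ∧ t ≤ p.eval n ∧ Outputs e τ B ∧
        B ⊆ A ∧ β / 4 ≤ X.twoStep.measure B ∧ (X.twoStep.induce B).lam ≤ 99 / 100) := by
  refine ⟨fun V₂ V₁ _ _ α β δ X A hα hβ hδ hαβ hδβ hX hA => ?_, exists_search_prog⟩
  obtain ⟨P, p, h⟩ := exists_search_prog.{u, v}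
  obtain ⟨-, -, B, -, -, -, hB⟩ :=
    h V₂ V₁ _ (Fintype.equivFin V₂) α β δ X A hα hβ hδ hαβ hδβ hX hA
  exact ⟨B, hB⟩
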